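/- For an integer $N\ge 0$ let $H(N)$ be the Hurwitz class number: $H(N)=0$ if $N\equiv 1,2\pmod 4$; $H(0)=-1/12$; and if $N>0$, $N\equiv 0,3\pmod 4$, then $H(N)$ is the number of $SL_2(\mathbb Z)$-classes of (not necessarily primitive) positive definite integral binary quadratic forms $ax^2+bxy+cy^2$ of discriminant $b^2-4ac=-N$, where a class containing a multiple of $x^2+y^2$ is counted with weight $1/2$ and a class containing a multiple of $x^2+xy+y^2$ with weight $1/3$. Let $F$ be Kronecker's class number on integers $\equiv 3 \pmod 4$: $F(8n+7)=H(8n+7)$ and $F(8n+3)=3H(8n+3)$ for $n\ge 0$, and $F(-1)=0$. For a complex number $q$ with $|q|<1$ put $$J_k=\prod_{n=0}^{\infty}\bigl(1-q^{k}(q^{k})^{n}\bigr)=(q^k;q^k)_\infty,\qquad \mathscr F_{4,-1}(q)=\sum_{n=0}^{\infty}F(4n-1)\,q^n .$$ Then, for every complex $q$ with $|q|<1$, the products $J_1$, $J_2$ converge, $J_2\ne0$, $1+q^{2k-1}\neq 0$ for all $k\ge 1$, the series $\mathscr F_{4,-1}(q)$ and the series on the right-hand side below converge absolutely, and $$\frac{J_1^2}{J_2}\,\mathscr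 F_{4,-1}(q)=\sum_{k=1}^{\infty}\frac{(-1)^{k-1}(2k-1)\,q^{k^2}}{1+q^{2k-1}} .$$ -/

import Mathlib

/-- The binary quadratic form `a x² + b x y + c y²` with integer coefficients. -/
@[ext]
structure BinForm where
  a : ℤ
  b : ℤ
  c : ℤ

namespace BinForm

/-- The value of the form at a point with coordinates in a commutative ring. -/
def eval {R : Type*} [CommRing R] (f : BinForm) (x y : R) : R :=
  (f.a : R) * x ^ 2 + (f.b : R) * x * y + (f.c : R) * y ^ 2

/-- The discriminant `b² - 4ac`. -/
def disc (f : BinForm) : ℤ := f.b ^ 2 - 4 * f.a * f.c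

/-- Positive definiteness, as a real quadratic form. -/
def PosDef (f : BinForm) : Prop :=
  ∀ x y : ℝ, (x, y) ≠ (0, 0) → 0 < f.eval x y

/-- (Proper) equivalence: `g(x, y) = f(γ (x, y))` for some `γ ∈ SL₂(ℤ)`. -/
def Equivalent (f g : BinForm) : Prop :=
  ∃ γ : Matrix.SpecialLinearGroup (Fin 2) ℤ, ∀ x y : ℤ,
    g.eval x y = f.eval (γ 0 0 * x + γ 0 1 * y) (γ 1 0 * x + γ 1 1 * y)

theorem Equivalent.refl (f : BinForm) : f.Equivalent f :=
  ⟨1, fun x y => by simp⟩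

theorem Equivalent.symm {f g : BinForm} (h : f.Equivalent g) : g.Equivalent f := by
  obtain ⟨γ, hγ⟩ := h
  have hd : γ 0 0 * γ 1 1 - γ 0 1 * γ 1 0 = 1 := by
    have := γ.det_coe
    rwa [Matrix.det_fin_two] at this
  refine ⟨γ⁻¹, fun x y => ?_⟩
  rw [hγ]
  simp only [Matrix.SpecialLinearGroup.coe_inv, Matrix.adjugate_fin_two, Matrix.of_apply,
    Matrix.cons_val', Matrix.cons_val_zero, Matrix.cons_val_one, Matrix.cons_val_fin_one]
  congr 1
  · linear_combination (-x) * hd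
  · linear_combination (-y) * hd

theorem Equivalent.trans {f g h : BinForm} (h₁ : f.Equivalent g) (h₂ : g.Equivalent h) :
    f.Equivalent h := by
  obtain ⟨γ, hγ⟩ := h₁
  obtain ⟨δ, hδ⟩ := h₂
  refine ⟨γ * δ, fun x y => ?_⟩
  rw [hδ, hγ]
  simp only [Matrix.SpecialLinearGroup.coe_mul, Matrix.mul_apply, Fin.sum_univ_two]
  congr 1 <;> ring

end BinForm

/-- The positive definite integral binary quadratic forms (primitive or not) of
discriminant `-N`. -/
abbrev PosForm (N : ℕ) : Type :=
  {f : BinForm // f.PosDef ∧ f.disc = -(N : ℤ)}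

instance PosForm.setoid (N : ℕ) : Setoid (PosForm N) where
  r f g := f.1.Equivalent g.1
  iseqv := ⟨fun f => .refl f.1, fun h => h.symm, fun h₁ h₂ => h₁.trans h₂⟩

/-- The `SL₂(ℤ)`-classes of positive definite forms of discriminant `-N`. -/
abbrev FormClass (N : ℕ) : Type := Quotient (PosForm.setoid N)

open Classical in
/-- The weight of a class: `1/2` if it contains a multiple of `x² + y²`, `1/3` if it contains a
multiple of `x² + xy + y²`, and `1` otherwise. -/
noncomputable def FormClass.weight {N : ℕ} (C : FormClass N) : ℚ :=
  if ∃ f : PosForm N, ⟦f⟧ = C ∧ ∃ k : ℤ, f.1 = ⟨k, 0, k⟩ then 1 / 2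
  else if ∃ f : PosForm N, ⟦f⟧ = C ∧ ∃ k : ℤ, f.1 = ⟨k, k, k⟩ then 1 / 3
  else 1

/-- The Hurwitz class number `H(N)`. (For `N > 0` the sum over classes is finite, see
`FormClass.finite`.) -/
noncomputable def hurwitzH (N : ℕ) : ℚ :=
  if N % 4 = 1 ∨ N % 4 = 2 then 0
  else if N = 0 then -1 / 12
  else ∑ᶠ C : FormClass N, C.weight

namespace BinForm

theorem PosDef.a_pos {f : BinForm} (h : f.PosDef) : 0 < f.a := by
  have := h 1 0 (by simp)
  simpa [eval] using this

theorem posDef_of_a_pos {f : BinForm} (ha : 0 < f.a) (hd : f.disc < 0) : f.PosDef := by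
  intro x y hxy
  have ha' : (0 : ℝ) < f.a := by exact_mod_cast ha
  have hd' : (f.b : ℝ) ^ 2 - 4 * f.a * f.c < 0 := by
    have : ((f.disc : ℤ) : ℝ) < 0 := by exact_mod_cast hd
    simpa [disc] using this
  have key : 4 * (f.a : ℝ) * f.eval x y
      = (2 * f.a * x + f.b * y) ^ 2 + -((f.b : ℝ) ^ 2 - 4 * f.a * f.c) * y ^ 2 := by
    unfold eval; ring
  have hpos : 0 < 4 * (f.a : ℝ) * f.eval x y := by
    rw [key]
    by_cases hy : y = 0
    · subst hy
      have hx : x ≠ 0 := by rintro rfl; exact hxy rfl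
      have : 0 < (2 * (f.a : ℝ) * x) ^ 2 := by positivity
      simpa using this
    · have : 0 < -((f.b : ℝ) ^ 2 - 4 * f.a * f.c) * y ^ 2 :=
        mul_pos (by linarith) (by positivity)
      nlinarith [sq_nonneg (2 * (f.a : ℝ) * x + f.b * y)]
  exact (mul_pos_iff_of_pos_left (by linarith)).1 hpos

/-- The shear `(x, y) ↦ (x + t y, y)`. -/
theorem equivalent_shift (f : BinForm) (t : ℤ) :
    f.Equivalent ⟨f.a, f.b + 2 * f.a * t, f.a * t ^ 2 + f.b * t + f.c⟩ := by
  refine ⟨⟨!![1, t; 0, 1], by simp [Matrix.det_fin_two]⟩, fun x y => ?_⟩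
  simp [eval]
  ring

/-- The rotation `(x, y) ↦ (-y, x)`. -/
theorem equivalent_swap (f : BinForm) : f.Equivalent ⟨f.c, -f.b, f.a⟩ := by
  refine ⟨⟨!![0, -1; 1, 0], by simp [Matrix.det_fin_two]⟩, fun x y => ?_⟩
  simp [eval]
  ring

theorem exists_reduced (D : ℤ) (hD : D < 0) (n : ℕ) :
    ∀ f : BinForm, 0 < f.a → f.a.toNat ≤ n → f.disc = D →
      ∃ g : BinForm, f.Equivalent g ∧ 0 < g.a ∧ g.disc = D ∧ |g.b| ≤ g.a ∧ g.a ≤ g.c := by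
  induction n with
  | zero => intro f ha hn; omega
  | succ n ih =>
    intro f ha hn hf
    set t : ℤ := -((f.b + f.a) / (2 * f.a)) with ht
    set g : BinForm := ⟨f.a, f.b + 2 * f.a * t, f.a * t ^ 2 + f.b * t + f.c⟩ with hg
    have hfg : f.Equivalent g := equivalent_shift f t
    have hgd : g.disc = D := by rw [← hf]; simp only [hg, disc]; ring
    have hgb : |g.b| ≤ g.a := by
      have h1 := Int.emod_add_mul_ediv (f.b + f.a) (2 * f.a)
      have h2 := Int.emod_nonneg (f.b + f.a) (show 2 * f.a ≠ 0 by omega)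
      have h3 := Int.emod_lt_of_pos (f.b + f.a) (show 0 < 2 * f.a by omega)
      have h4 : g.b = (f.b + f.a) % (2 * f.a) - f.a := by
        simp only [hg, ht]; linarith
      have h5 : g.a = f.a := rfl
      rw [abs_le]; constructor <;> linarith
    by_cases hc : g.a ≤ g.c
    · exact ⟨g, hfg, ha, hgd, hgb, hc⟩
    · have hga : g.a = f.a := rfl
      have hcpos : 0 < g.c := by
        have h1 : g.b ^ 2 - 4 * g.a * g.c < 0 := by
          have : g.disc < 0 := by omega
          simpa only [disc] using this
        by_contra hneg
        nlinarith [sq_nonneg g.b, mul_nonneg (show 0 ≤ g.a by omega) (show 0 ≤ -g.c by omega)]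
      obtain ⟨g', h1, h2⟩ := ih ⟨g.c, -g.b, g.a⟩ hcpos (by simp only; omega)
        (by rw [← hgd]; simp only [disc]; ring)
      exact ⟨g', (hfg.trans (equivalent_swap g)).trans h1, h2⟩

end BinForm

/-- There are finitely many classes of each negative discriminant. -/
theorem FormClass.finite (N : ℕ) (hN : 0 < N) : Finite (FormClass N) := by
  have hN' : (0 : ℤ) < N := by exact_mod_cast hN
  let S : Set (PosForm N) := {g | |g.1.b| ≤ g.1.a ∧ g.1.a ≤ g.1.c}
  have hS : S.Finite := by
    let M : ℤ := (N : ℤ) ^ 2 + N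
    let φ : PosForm N → ℤ × ℤ × ℤ := fun g => (g.1.a, g.1.b, g.1.c)
    have hφ : Function.Injective φ := by
      intro g h hgh
      simp only [φ, Prod.mk.injEq] at hgh
      exact Subtype.ext (BinForm.ext hgh.1 hgh.2.1 hgh.2.2)
    refine Set.Finite.of_finite_image
      (((Set.finite_Icc (-M) M).prod ((Set.finite_Icc (-M) M).prod
        (Set.finite_Icc (-M) M))).subset ?_) hφ.injOn
    rintro _ ⟨g, ⟨hb, hc⟩, rfl⟩
    have ha := g.2.1.a_pos
    have hd : g.1.b ^ 2 - 4 * g.1.a * g.1.c = -(N : ℤ) := g.2.2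
    rw [abs_le] at hb
    have hb2 : g.1.b ^ 2 ≤ g.1.a ^ 2 := by nlinarith
    have hac : g.1.a ^ 2 ≤ g.1.a * g.1.c := by nlinarith
    have haN : g.1.a ≤ N := by nlinarith
    have hcM : g.1.c ≤ M := by
      simp only [M]; nlinarith
    have hNM : (N : ℤ) ≤ M := by simp only [M]; nlinarith
    simp only [φ, Set.mem_prod, Set.mem_Icc]
    refine ⟨⟨?_, ?_⟩, ⟨?_, ?_⟩, ?_, ?_⟩ <;> linarith
  have : Finite S := hS.to_subtype
  refine Finite.of_surjective (fun g : S => (⟦g.1⟧ : FormClass N)) ?_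
  intro C
  induction C using Quotient.inductionOn with
  | h f =>
    obtain ⟨g, h1, h2, h3, h4, h5⟩ :=
      BinForm.exists_reduced (-(N : ℤ)) (by omega) _ f.1 f.2.1.a_pos le_rfl f.2.2
    exact ⟨⟨⟨g, BinForm.posDef_of_a_pos h2 (by omega), h3⟩, h4, h5⟩,
      Quotient.sound h1.symm⟩

/-- Kronecker's class number `F` on the arguments `N ≡ 3 (mod 4)`: `F(8n+7) = H(8n+7)` and
`F(8n+3) = 3 H(8n+3)` for `n ≥ 0`, and `F(N) = 0` for negative `N`. No other residue classes
occur in `F(4n-1)`; there the value is set to `0`. -/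
noncomputable def kroneckerF (N : ℤ) : ℚ :=
  if N < 0 then 0
  else if N % 8 = 7 then hurwitzH N.toNat
  else if N % 8 = 3 then 3 * hurwitzH N.toNat
  else 0

/-- The generating function `∑_{n ≥ 0} F(4n-1) qⁿ`. -/
noncomputable def genF4 (q : ℂ) : ℂ :=
  ∑' n : ℕ, (kroneckerF (4 * n - 1) : ℂ) * q ^ n

/-- The infinite `q`-Pochhammer symbol `(a; q)_∞ = ∏_{k ≥ 0} (1 - a q^k)`. -/
noncomputable def qPochInf (a q : ℂ) : ℂ := ∏' k : ℕ, (1 - a * q ^ k)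

/-- `J_k = (q^k; q^k)_∞`. -/
noncomputable def bigJ (k : ℕ) (q : ℂ) : ℂ := qPochInf (q ^ k) (q ^ k)

/-! For N ≡ 3 (mod 4) every positive definite form of discriminant -N is properly equivalent to (xX²
+ yY² + z(X+Y)²)/2 with x, y, z odd, positive and xy + yz + zx = N, and the triple is unique up to
cyclic rotation (`SellingTriple.formClass_eq_iff`). The weights 1 and 1/3 match orbits of size 3 and
1, so 3H(N) counts the triples. Requiring x ≡ y (mod 4) keeps all of them when N ≡ 3 (mod 8) and a
third when N ≡ 7 (mod 8), so F(N) counts these restricted triples.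

Writing x, y = 2m+1 ∓ 2s and z = 2j+1 turns N = 4n-1 into n = (m+1)² - s² + (2m+1)j. Hence the
generating function is the sum of q^n over |s| ≤ m and j ≥ 0 (`HermiteIndex.genF4_eq_tsum`).

By Gauss, J₁²/J₂ = ∑ (-1)^t q^(t²) (`gauss_theta_product`). In the product of the two series put p =
t - s: the exponent t² - s² = p² + 2ps becomes linear in s, so the sums over s and j are geometric.
What remains is twice a double series over n ∈ ℤ, m ≥ 0 (`theta_mul_tsum`). Pairing n = k+1 with n =
-k, partial fractions turn the sum over m into a telescoping series with value (2k+1)/2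
(`hasSum_fermiTerm_sub`), which gives the right-hand side. -/

open Filter Topology

/-! ### Selling parameters of a form and their uniqueness -/

/-- The form `(x X² + y Y² + z (X + Y)²) / 2` attached to a triple of odd integers. -/
def sellingForm (x y z : ℤ) : BinForm := ⟨(x + z) / 2, z, (y + z) / 2⟩

theorem two_mul_sellingForm_eval {x y z : ℤ} (hx : x % 2 = 1) (hy : y % 2 = 1) (hz : z % 2 = 1)
    (X Y : ℤ) : 2 * (sellingForm x y z).eval X Y = x * X ^ 2 + y * Y ^ 2 + z * (X + Y) ^ 2 := by
  have h1 : 2 * ((x + z) / 2) = x + z := by omega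
  have h2 : 2 * ((y + z) / 2) = y + z := by omega
  simp only [sellingForm, BinForm.eval, Int.cast_id]
  linear_combination X ^ 2 * h1 + Y ^ 2 * h2

theorem sellingForm_disc {x y z : ℤ} (hx : x % 2 = 1) (hy : y % 2 = 1) (hz : z % 2 = 1) :
    (sellingForm x y z).disc = -(x * y + y * z + z * x) := by
  have h1 : 2 * ((x + z) / 2) = x + z := by omega
  have h2 : 2 * ((y + z) / 2) = y + z := by omega
  simp only [sellingForm, BinForm.disc]
  linear_combination (-2 * ((y + z) / 2)) * h1 - (x + z) * h2

/-- The substitution (X, Y) ↦ (Y, -X-Y) permutes X², Y², (X+Y)² cyclically. -/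
theorem sellingForm_equivalent_rotate {x y z : ℤ} (hx : x % 2 = 1) (hy : y % 2 = 1)
    (hz : z % 2 = 1) : (sellingForm x y z).Equivalent (sellingForm z x y) := by
  refine ⟨⟨!![0, 1; -1, -1], by simp [Matrix.det_fin_two]⟩, fun X Y => ?_⟩
  have h1 := two_mul_sellingForm_eval hz hx hy X Y
  have h2 := two_mul_sellingForm_eval hx hy hz Y (-X - Y)
  simp
  rw [show -X + -Y = -X - Y by ring]
  linarith

/-- The values of `u² + v² + (u - v)²` at nonzero integer vectors are at least `2`. -/
theorem two_le_sq_add_sq_add_sub_sq {u v : ℤ} (h : u ≠ 0 ∨ v ≠ 0) :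
    2 ≤ u ^ 2 + v ^ 2 + (u - v) ^ 2 := by
  have h1 : 0 < u ^ 2 + v ^ 2 := by
    rcases h with h | h <;> positivity
  have h2 : u ^ 2 + v ^ 2 + (u - v) ^ 2 = 2 * (u ^ 2 - u * v + v ^ 2) := by ring
  have h3 := sq_nonneg (u - v)
  omega

theorem abs_le_one_of_sq_add_sq_add_sub_sq {u v : ℤ} (h : u ^ 2 + v ^ 2 + (u - v) ^ 2 = 2) :
    (-1 ≤ u ∧ u ≤ 1) ∧ (-1 ≤ v ∧ v ≤ 1) := by
  refine ⟨⟨?_, ?_⟩, ?_, ?_⟩ <;> nlinarith [sq_nonneg (u - v), sq_nonneg u, sq_nonneg v]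

/-- Adding the values at (1,0), (0,1) and (1,-1) gives 2(x'+y'+z') = x·A + y·B + z·C. Here A, B, C
are the values of u² + v² + (u-v)² at the two rows of γ and at their sum. These vectors are nonzero
because det γ = 1, so each value is at least 2. -/
theorem selling_sum_le {x y z x' y' z' : ℤ} (hx : 0 < x) (hy : 0 < y) (hz : 0 < z)
    (ox : x % 2 = 1) (oy : y % 2 = 1) (oz : z % 2 = 1)
    (ox' : x' % 2 = 1) (oy' : y' % 2 = 1) (oz' : z' % 2 = 1)
    (h : (sellingForm x y z).Equivalent (sellingForm x' y' z')) :
    x + y + z ≤ x' + y' + z' := by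
  obtain ⟨γ, hγ⟩ := h
  have hd : γ 0 0 * γ 1 1 - γ 0 1 * γ 1 0 = 1 := by
    have := γ.det_coe
    rwa [Matrix.det_fin_two] at this
  generalize γ 0 0 = p, γ 0 1 = r, γ 1 0 = s, γ 1 1 = t at hγ hd
  have e : ∀ X Y : ℤ, x' * X ^ 2 + y' * Y ^ 2 + z' * (X + Y) ^ 2 =
      x * (p * X + r * Y) ^ 2 + y * (s * X + t * Y) ^ 2
        + z * ((p * X + r * Y) + (s * X + t * Y)) ^ 2 := fun X Y => by
    rw [← two_mul_sellingForm_eval ox' oy' oz', ← two_mul_sellingForm_eval ox oy oz, hγ]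
  have e1 := e 1 0
  have e2 := e 0 1
  have e3 := e 1 (-1)
  have n1 : p ≠ 0 ∨ r ≠ 0 := by
    by_contra! hh; simp [hh.1, hh.2] at hd
  have n2 : s ≠ 0 ∨ t ≠ 0 := by
    by_contra! hh; simp [hh.1, hh.2] at hd
  have n3 : p + s ≠ 0 ∨ r + t ≠ 0 := by
    by_contra! hh
    have h1 : s = -p := by linarith [hh.1]
    have h2 : t = -r := by linarith [hh.2]
    subst h1 h2
    ring_nf at hd
    omega
  have m1 := mul_le_mul_of_nonneg_left (two_le_sq_add_sq_add_sub_sq n1) hx.le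
  have m2 := mul_le_mul_of_nonneg_left (two_le_sq_add_sq_add_sub_sq n2) hy.le
  have m3 := mul_le_mul_of_nonneg_left (two_le_sq_add_sq_add_sub_sq n3) hz.le
  linarith

/-- Equivalence is symmetric, so the two parameter sums agree. All three bounds behind
`selling_sum_le` are then equalities, which leaves finitely many γ to inspect. -/
theorem selling_rotate_of_equivalent {x y z x' y' z' : ℤ} (hx : 0 < x) (hy : 0 < y) (hz : 0 < z)
    (hx' : 0 < x') (hy' : 0 < y') (hz' : 0 < z')
    (ox : x % 2 = 1) (oy : y % 2 = 1) (oz : z % 2 = 1)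
    (ox' : x' % 2 = 1) (oy' : y' % 2 = 1) (oz' : z' % 2 = 1)
    (h : (sellingForm x y z).Equivalent (sellingForm x' y' z')) :
    (x' = x ∧ y' = y ∧ z' = z) ∨ (x' = z ∧ y' = x ∧ z' = y) ∨ (x' = y ∧ y' = z ∧ z' = x) := by
  have hs := selling_sum_le hx' hy' hz' ox' oy' oz' ox oy oz h.symm
  obtain ⟨γ, hγ⟩ := h
  have hd : γ 0 0 * γ 1 1 - γ 0 1 * γ 1 0 = 1 := by
    have := γ.det_coe
    rwa [Matrix.det_fin_two] at this
  generalize γ 0 0 = p, γ 0 1 = r, γ 1 0 = s, γ 1 1 = t at hγ hd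
  have e : ∀ X Y : ℤ, x' * X ^ 2 + y' * Y ^ 2 + z' * (X + Y) ^ 2 =
      x * (p * X + r * Y) ^ 2 + y * (s * X + t * Y) ^ 2
        + z * ((p * X + r * Y) + (s * X + t * Y)) ^ 2 := fun X Y => by
    rw [← two_mul_sellingForm_eval ox' oy' oz', ← two_mul_sellingForm_eval ox oy oz, hγ]
  have e1 := e 1 0
  have e2 := e 0 1
  have e3 := e 1 (-1)
  have n1 : p ≠ 0 ∨ r ≠ 0 := by
    by_contra! hh; simp [hh.1, hh.2] at hd
  have n2 : s ≠ 0 ∨ t ≠ 0 := by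
    by_contra! hh; simp [hh.1, hh.2] at hd
  have n3 : p + s ≠ 0 ∨ r + t ≠ 0 := by
    by_contra! hh
    have h1 : s = -p := by linarith [hh.1]
    have h2 : t = -r := by linarith [hh.2]
    subst h1 h2
    ring_nf at hd
    omega
  have m1 := two_le_sq_add_sq_add_sub_sq n1
  have m2 := two_le_sq_add_sq_add_sub_sq n2
  have m3 := two_le_sq_add_sq_add_sub_sq n3
  have k1 := mul_le_mul_of_nonneg_left m1 hx.le
  have k2 := mul_le_mul_of_nonneg_left m2 hy.le
  have k3 := mul_le_mul_of_nonneg_left m3 hz.le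
  have q1 : p ^ 2 + r ^ 2 + (p - r) ^ 2 = 2 :=
    mul_left_cancel₀ hx.ne' (by linarith)
  have q2 : s ^ 2 + t ^ 2 + (s - t) ^ 2 = 2 :=
    mul_left_cancel₀ hy.ne' (by linarith)
  have q3 : (p + s) ^ 2 + (r + t) ^ 2 + (p + s - (r + t)) ^ 2 = 2 :=
    mul_left_cancel₀ hz.ne' (by linarith)
  obtain ⟨⟨p1, p2⟩, r1, r2⟩ := abs_le_one_of_sq_add_sq_add_sub_sq q1
  obtain ⟨⟨s1, s2⟩, t1, t2⟩ := abs_le_one_of_sq_add_sq_add_sub_sq q2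
  clear m1 m2 m3 k1 k2 k3 n1 n2 n3 e hγ
  interval_cases p <;> interval_cases r <;> norm_num at q1 <;>
    interval_cases s <;> interval_cases t <;> norm_num at q2 <;> norm_num at q3 <;>
    norm_num at hd <;> (norm_num at e1 e2 e3; try omega)

/-! ### Class numbers as counts of odd triples -/

/-- Triples of odd positive integers with `xy + yz + zx = N`. -/
@[ext]
structure SellingTriple (N : ℕ) where
  x : ℤ
  y : ℤ
  z : ℤ
  x_pos : 0 < x
  y_pos : 0 < y
  z_pos : 0 < z
  x_odd : x % 2 = 1
  y_odd : y % 2 = 1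
  z_odd : z % 2 = 1
  sum_eq : x * y + y * z + z * x = N

namespace SellingTriple

variable {N : ℕ}

instance : Finite (SellingTriple N) := by
  have hinj : Function.Injective
      (fun t : SellingTriple N => ((t.x, t.y, t.z) : ℤ × ℤ × ℤ)) := by
    intro t u h
    simp only [Prod.mk.injEq] at h
    exact SellingTriple.ext h.1 h.2.1 h.2.2
  refine Set.finite_univ_iff.1 (Set.Finite.of_finite_image
    (((Set.finite_Icc (0 : ℤ) N).prod ((Set.finite_Icc (0 : ℤ) N).prod
      (Set.finite_Icc (0 : ℤ) N))).subset ?_) hinj.injOn)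
  rintro _ ⟨t, -, rfl⟩
  have h := t.sum_eq
  have hx := t.x_pos
  have hy := t.y_pos
  have hz := t.z_pos
  simp only [Set.mem_prod, Set.mem_Icc]
  refine ⟨⟨hx.le, ?_⟩, ⟨hy.le, ?_⟩, hz.le, ?_⟩ <;>
    nlinarith [mul_pos hx hy, mul_pos hy hz, mul_pos hz hx]

/-- The cyclic rotation of a triple. -/
def rotate : SellingTriple N ≃ SellingTriple N where
  toFun t := ⟨t.z, t.x, t.y, t.z_pos, t.x_pos, t.y_pos, t.z_odd, t.x_odd, t.y_odd, by
    rw [← t.sum_eq]; ring⟩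
  invFun t := ⟨t.y, t.z, t.x, t.y_pos, t.z_pos, t.x_pos, t.y_odd, t.z_odd, t.x_odd, by
    rw [← t.sum_eq]; ring⟩
  left_inv _ := rfl
  right_inv _ := rfl

/-- The positive definite form of discriminant `-N` attached to a triple. -/
def form (t : SellingTriple N) : PosForm N :=
  ⟨sellingForm t.x t.y t.z, by
    have hx := t.x_pos
    have hy := t.y_pos
    have hz := t.z_pos
    have hd := sellingForm_disc t.x_odd t.y_odd t.z_odd
    refine ⟨BinForm.posDef_of_a_pos ?_ ?_, by rw [hd, t.sum_eq]⟩
    · simp only [sellingForm]; omega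
    · rw [hd]; nlinarith [mul_pos hx hy, mul_pos hy hz, mul_pos hz hx]⟩

/-- The class of the form attached to a triple. -/
def formClass (t : SellingTriple N) : FormClass N := ⟦t.form⟧

theorem formClass_rotate (t : SellingTriple N) : (rotate t).formClass = t.formClass :=
  Quotient.sound (BinForm.Equivalent.symm
    (sellingForm_equivalent_rotate t.x_odd t.y_odd t.z_odd))

theorem formClass_eq_iff (t u : SellingTriple N) :
    u.formClass = t.formClass ↔ u = t ∨ u = rotate t ∨ u = rotate (rotate t) := by
  constructor
  · intro h
    have h' : t.form.1.Equivalent u.form.1 := (Quotient.exact h).symm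
    rcases selling_rotate_of_equivalent t.x_pos t.y_pos t.z_pos u.x_pos u.y_pos u.z_pos
      t.x_odd t.y_odd t.z_odd u.x_odd u.y_odd u.z_odd h' with h | h | h
    · exact Or.inl (SellingTriple.ext h.1 h.2.1 h.2.2)
    · exact Or.inr (Or.inl (SellingTriple.ext h.1 h.2.1 h.2.2))
    · exact Or.inr (Or.inr (SellingTriple.ext h.1 h.2.1 h.2.2))
  · rintro (rfl | rfl | rfl) <;> simp only [formClass_rotate]

/-- A reduced form has |b| ≤ a ≤ c, and b is odd since N is odd. For b > 0 the parameters 2a-b,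
2c-b, b are positive. -/
theorem formClass_surjective (hN : N % 4 = 3) :
    Function.Surjective (formClass : SellingTriple N → FormClass N) := by
  intro C
  induction C using Quotient.inductionOn with
  | h f =>
  obtain ⟨g, h1, h2, h3, h4, h5⟩ :=
    BinForm.exists_reduced (-(N : ℤ)) (by omega) _ f.1 f.2.1.a_pos le_rfl f.2.2
  have hd : g.b ^ 2 - 4 * g.a * g.c = -(N : ℤ) := h3
  have hb : g.b % 2 = 1 := by
    rcases Int.emod_two_eq_zero_or_one g.b with h | h
    · exfalso
      obtain ⟨b, hb⟩ : ∃ b, g.b = 2 * b := ⟨g.b / 2, by omega⟩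
      rw [hb] at hd
      have : 4 * (b ^ 2 - g.a * g.c) = -(N : ℤ) := by rw [← hd]; ring
      omega
    · exact h
  rw [abs_le] at h4
  rcases lt_or_ge 0 g.b with hpos | hneg
  · refine ⟨⟨2 * g.a - g.b, 2 * g.c - g.b, g.b, by omega, by omega, hpos, by omega, by omega, hb,
      by linear_combination -hd⟩, Quotient.sound (BinForm.Equivalent.symm ?_)⟩
    convert h1
    ext <;> simp only [form, sellingForm] <;> omega
  -- Here b < 0; the shear by 1 replaces the middle coefficient by b + 2a > 0, and these are the
  -- parameters of the sheared form.
  · refine ⟨⟨-g.b, 2 * g.c + g.b, g.b + 2 * g.a, by omega, by omega, by omega, by omega, by omega,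
      by omega, by linear_combination -hd⟩, Quotient.sound (BinForm.Equivalent.symm ?_)⟩
    have h6 := h1.trans (g.equivalent_shift 1)
    have h7 : sellingForm (-g.b) (2 * g.c + g.b) (g.b + 2 * g.a) =
        ⟨g.a, g.b + 2 * g.a * 1, g.a * 1 ^ 2 + g.b * 1 + g.c⟩ := by
      ext <;> simp only [sellingForm] <;> omega
    rw [← h7] at h6
    exact h6

/-- A fibre is a rotation orbit, of size 1 exactly when x = y = z, that is, when the class contains
a multiple of X² + XY + Y². Weight 1/2 would force N = 4k². -/
theorem ncard_fiber_eq_weight (hN : N % 4 = 3) (t : SellingTriple N) :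
    (Set.ncard {u : SellingTriple N | u.formClass = t.formClass} : ℚ) =
      3 * t.formClass.weight := by
  have hset : {u : SellingTriple N | u.formClass = t.formClass} =
      {t, rotate t, rotate (rotate t)} := by
    ext u; simp [formClass_eq_iff]
  rw [hset, FormClass.weight, if_neg]
  swap
  · rintro ⟨f, -, k, hk⟩
    have hd := f.2.2
    rw [hk] at hd
    simp only [BinForm.disc] at hd
    have : 4 * (k * k) = (N : ℤ) := by linarith
    omega
  by_cases ht : t.x = t.y ∧ t.y = t.z
  · have h1 : rotate t = t := SellingTriple.ext (by simp [rotate, ht.1, ht.2])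
      (by simp [rotate, ht.1]) (by simp [rotate, ht.2])
    rw [if_pos]
    · simp [h1]
    · refine ⟨t.form, rfl, t.z, ?_⟩
      ext <;> simp only [form, sellingForm] <;> omega
  · rw [if_neg]
    · have d1 : t ≠ rotate t := fun h => ht (by
        have h1 := congrArg SellingTriple.x h
        have h2 := congrArg SellingTriple.y h
        simp only [rotate, Equiv.coe_fn_mk] at h1 h2
        omega)
      have d2 : t ≠ rotate (rotate t) := fun h => ht (by
        have h1 := congrArg SellingTriple.x h
        have h2 := congrArg SellingTriple.y h
        simp only [rotate, Equiv.coe_fn_mk] at h1 h2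
        omega)
      have d3 : rotate t ≠ rotate (rotate t) := fun h => d1 (rotate.injective h)
      rw [Set.ncard_eq_three.2 ⟨_, _, _, d1, d2, d3, rfl⟩]
      norm_num
    · rintro ⟨f, hf, k, hk⟩
      have hkpos : 0 < k := by
        have := f.2.1.a_pos
        rwa [hk] at this
      have hd := f.2.2
      rw [hk] at hd
      simp only [BinForm.disc] at hd
      have hd' : 3 * (k * k) = (N : ℤ) := by linarith
      have hodd : k % 2 = 1 := by
        rcases Int.emod_two_eq_zero_or_one k with h | h
        · exfalso
          obtain ⟨b, rfl⟩ : ∃ b, k = 2 * b := ⟨k / 2, by omega⟩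
          have : 4 * (3 * (b * b)) = (N : ℤ) := by rw [← hd']; ring
          omega
        · exact h
      let u : SellingTriple N := ⟨k, k, k, hkpos, hkpos, hkpos, hodd, hodd, hodd, by linarith⟩
      have hu : u.form = f := by
        refine Subtype.ext ?_
        rw [hk]
        ext <;> simp only [form, sellingForm, u] <;> omega
      have hut : t.formClass = u.formClass := by rw [← hf, ← hu]; rfl
      rcases (formClass_eq_iff u t).1 hut with h | h | h <;>
        exact ht (by subst h; exact ⟨rfl, rfl⟩)

theorem card_eq_three_mul_hurwitzH (hN : N % 4 = 3) :
    (Nat.card (SellingTriple N) : ℚ) = 3 * hurwitzH N := by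
  have hfin : Finite (FormClass N) := FormClass.finite N (by omega)
  have := Fintype.ofFinite (FormClass N)
  rw [hurwitzH, if_neg (by omega), if_neg (by omega), finsum_eq_sum_of_fintype, Finset.mul_sum,
    ← Nat.card_congr (Equiv.sigmaFiberEquiv (formClass : SellingTriple N → FormClass N)),
    Nat.card_sigma]
  push_cast
  refine Finset.sum_congr rfl fun C _ => ?_
  obtain ⟨t, rfl⟩ := formClass_surjective hN C
  exact ncard_fiber_eq_weight hN t

/-- Modulo 4 the odd entries take two values. All three agree when N ≡ 3 (mod 8), and exactly two
agree when N ≡ 7 (mod 8). -/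
theorem kroneckerF_eq_card (hN : N % 4 = 3) :
    kroneckerF N = (Nat.card {t : SellingTriple N // t.x % 4 = t.y % 4} : ℚ) := by
  have hcard := card_eq_three_mul_hurwitzH hN
  have key : ∀ t : SellingTriple N, ∃ i j k : ℤ,
      t.x = 2 * i + 1 ∧ t.y = 2 * j + 1 ∧ t.z = 2 * k + 1 ∧
        4 * (i * j + j * k + k * i + i + j + k) + 3 = (N : ℤ) := fun t => by
    have hx := t.x_odd
    have hy := t.y_odd
    have hz := t.z_odd
    refine ⟨t.x / 2, t.y / 2, t.z / 2, by omega, by omega, by omega, ?_⟩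
    rw [← t.sum_eq]
    have h1 : t.x = 2 * (t.x / 2) + 1 := by omega
    have h2 : t.y = 2 * (t.y / 2) + 1 := by omega
    have h3 : t.z = 2 * (t.z / 2) + 1 := by omega
    generalize t.x / 2 = i at *
    generalize t.y / 2 = j at *
    generalize t.z / 2 = k at *
    rw [h1, h2, h3]
    ring
  -- With x, y, z = 2i+1, 2j+1, 2k+1, the integer (N-3)/4 = ij+jk+ki+i+j+k is even exactly when i,
  -- j, k have the same parity.
  have parity : ∀ t : SellingTriple N,
      (N % 8 = 3 → t.x % 4 = t.y % 4 ∧ t.y % 4 = t.z % 4) ∧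
      (N % 8 = 7 → ¬ (t.x % 4 = t.y % 4 ∧ t.y % 4 = t.z % 4)) := fun t => by
    obtain ⟨i, j, k, h1, h2, h3, h⟩ := key t
    rw [h1, h2, h3]
    generalize hS : i * j + j * k + k * i + i + j + k = S at h
    have hp : (i * j + j * k + k * i + i + j + k) % 2 = S % 2 := by rw [hS]
    rcases Int.emod_two_eq_zero_or_one i with hi | hi <;>
    rcases Int.emod_two_eq_zero_or_one j with hj | hj <;>
    rcases Int.emod_two_eq_zero_or_one k with hk | hk <;>
    · simp [Int.add_emod, Int.mul_emod, hi, hj, hk] at hp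
      omega
  have hneg : ¬ ((N : ℤ) < 0) := by omega
  rw [kroneckerF, if_neg hneg]
  rcases (by omega : N % 8 = 3 ∨ N % 8 = 7) with h8 | h8
  · rw [if_neg (by omega), if_pos (by omega), Int.toNat_natCast, ← hcard]
    congr 1
    exact Nat.card_congr (Equiv.subtypeUnivEquiv fun t => ((parity t).1 h8).1).symm
  · rw [if_pos (by omega), Int.toNat_natCast]
    have e1 : {t : SellingTriple N // t.x % 4 = t.y % 4} ≃
        {t : SellingTriple N // t.y % 4 = t.z % 4} :=
      rotate.subtypeEquiv fun t => by simp [rotate]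
    have e2 : {t : SellingTriple N // t.x % 4 = t.y % 4} ≃
        {t : SellingTriple N // t.z % 4 = t.x % 4} :=
      (rotate.trans rotate).subtypeEquiv fun t => by simp [rotate]
    -- Exactly one pair of entries agrees modulo 4, so the triples split into three classes, which
    -- rotation permutes.
    have hsum : Nat.card (SellingTriple N) =
        Nat.card {t : SellingTriple N // t.x % 4 = t.y % 4} +
        (Nat.card {t : SellingTriple N // t.y % 4 = t.z % 4} +
          Nat.card {t : SellingTriple N // t.z % 4 = t.x % 4}) := by
      classical
      have := Fintype.ofFinite (SellingTriple N)
      simp only [Nat.card_eq_fintype_card, Fintype.card_subtype]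
      rw [← Finset.card_union_of_disjoint, ← Finset.card_union_of_disjoint, ← Finset.card_univ]
      · congr 1
        ext t
        have hx := t.x_odd
        have hy := t.y_odd
        have hz := t.z_odd
        simp only [Finset.mem_univ, Finset.mem_union, Finset.mem_filter, true_and, true_iff]
        omega
      · rw [Finset.disjoint_left]
        intro t
        have := (parity t).2 h8
        simp only [Finset.mem_union, Finset.mem_filter, Finset.mem_univ, true_and]
        omega
      · rw [Finset.disjoint_left]
        intro t
        have := (parity t).2 h8
        simp only [Finset.mem_filter, Finset.mem_univ, true_and]
        omega
    rw [← Nat.card_congr e1, ← Nat.card_congr e2] at hsum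
    rw [hsum] at hcard
    push_cast at hcard
    linarith

end SellingTriple

/-! ### The generating function as a sum over (m, s, j) -/

/-- The index set `{(m, s, j) : |s| ≤ m}` of the expansion of `genF4`. -/
abbrev HermiteIndex : Type := {p : ℕ × ℤ × ℕ // |p.2.1| ≤ (p.1 : ℤ)}

namespace HermiteIndex

/-- The exponent `(m + 1)² - s² + (2m + 1) j`. -/
def deg (p : HermiteIndex) : ℕ :=
  (((p.1.1 : ℤ) + 1) ^ 2 - p.1.2.1 ^ 2 + (2 * p.1.1 + 1) * p.1.2.2).toNat

/-- Since |s| ≤ m, (m+1)² - s² = (m+1-|s|)(m+1+|s|) ≥ m+1+|s|. This bound makes `toNat` in `deg`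
harmless, excludes degree 0, and dominates the series by a product of geometric ones. -/
theorem add_natAbs_add_lt (p : HermiteIndex) :
    ((p.1.1 + p.1.2.1.natAbs + p.1.2.2 : ℕ) : ℤ) <
      ((p.1.1 : ℤ) + 1) ^ 2 - p.1.2.1 ^ 2 + (2 * p.1.1 + 1) * p.1.2.2 := by
  obtain ⟨⟨m, s, j⟩, h⟩ := p
  simp only at h ⊢
  push_cast
  have h1 : s ^ 2 = |s| ^ 2 := (sq_abs s).symm
  have h2 : (0 : ℤ) ≤ m * j := by positivity
  have h3 := abs_nonneg s
  rw [h1]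
  nlinarith

theorem coe_deg (p : HermiteIndex) : (p.deg : ℤ) =
    ((p.1.1 : ℤ) + 1) ^ 2 - p.1.2.1 ^ 2 + (2 * p.1.1 + 1) * p.1.2.2 :=
  Int.toNat_of_nonneg (by have := p.add_natAbs_add_lt; omega)

theorem add_natAbs_add_lt_deg (p : HermiteIndex) :
    p.1.1 + p.1.2.1.natAbs + p.1.2.2 < p.deg := by
  have := p.add_natAbs_add_lt
  rw [← coe_deg] at this
  exact_mod_cast this

/-- The triple attached to an index of exponent `n + 1`. -/
def toTriple {n : ℕ} (p : {p : HermiteIndex // p.deg = n + 1}) :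
    {t : SellingTriple (4 * n + 3) // t.x % 4 = t.y % 4} :=
  ⟨⟨2 * p.1.1.1 + 1 - 2 * p.1.1.2.1, 2 * p.1.1.1 + 1 + 2 * p.1.1.2.1, 2 * p.1.1.2.2 + 1,
    by have := abs_le.1 p.1.2; omega, by have := abs_le.1 p.1.2; omega, by omega, by omega,
    by omega, by omega, by
      have h := p.1.coe_deg
      rw [p.2] at h
      push_cast at h ⊢
      linear_combination -4 * h⟩, by simp only; omega⟩

theorem toTriple_bijective (n : ℕ) : Function.Bijective (toTriple (n := n)) := by
  constructor
  · rintro ⟨⟨⟨m, s, j⟩, h⟩, hp⟩ ⟨⟨⟨m', s', j'⟩, h'⟩, hp'⟩ hpp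
    have h1 := congrArg (fun t => t.1.x) hpp
    have h2 := congrArg (fun t => t.1.y) hpp
    have h3 := congrArg (fun t => t.1.z) hpp
    simp only [toTriple] at h1 h2 h3
    have e1 : m = m' := by omega
    have e2 : s = s' := by omega
    have e3 : j = j' := by omega
    subst e1 e2 e3
    rfl
  · rintro ⟨⟨x, y, z, hx, hy, hz, ox, oy, oz, hs⟩, hxy⟩
    simp only at hxy
    -- Two odd numbers congruent modulo 4 have sum ≡ 2 and difference ≡ 0 (mod 4), so m and s are
    -- integral; positivity of x and y is |s| ≤ m.
    obtain ⟨m, hm⟩ : ∃ m : ℕ, x + y = 4 * m + 2 := ⟨((x + y) / 4).toNat, by omega⟩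
    obtain ⟨s, hs'⟩ : ∃ s : ℤ, y - x = 4 * s := ⟨(y - x) / 4, by omega⟩
    obtain ⟨j, rfl⟩ : ∃ j : ℕ, z = 2 * j + 1 := ⟨(z / 2).toNat, by omega⟩
    obtain rfl : x = 2 * m + 1 - 2 * s := by omega
    obtain rfl : y = 2 * m + 1 + 2 * s := by omega
    let p : HermiteIndex := ⟨(m, s, j), by rw [abs_le]; constructor <;> simp only <;> omega⟩
    refine ⟨⟨p, ?_⟩, Subtype.ext (SellingTriple.ext rfl rfl rfl)⟩
    have h := p.coe_deg
    simp only [p] at h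
    push_cast at hs
    have : (p.deg : ℤ) = n + 1 := by
      simp only [p]
      linarith
    exact_mod_cast this

theorem kroneckerF_eq_card_fiber (n : ℕ) :
    kroneckerF (4 * n - 1) = (Nat.card {p : HermiteIndex // p.deg = n} : ℚ) := by
  cases n with
  | zero =>
    have : IsEmpty {p : HermiteIndex // p.deg = 0} :=
      ⟨fun p => by have := p.1.add_natAbs_add_lt_deg; have := p.2; omega⟩
    simp [kroneckerF]
  | succ n =>
    rw [show (4 * ((n + 1 : ℕ) : ℤ) - 1) = ((4 * n + 3 : ℕ) : ℤ) by push_cast; ring,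
      SellingTriple.kroneckerF_eq_card (by omega),
      Nat.card_congr (Equiv.ofBijective _ (toTriple_bijective n))]

theorem finite_fiber (n : ℕ) : Finite {p : HermiteIndex // p.deg = n} := by
  cases n with
  | zero =>
    have : IsEmpty {p : HermiteIndex // p.deg = 0} :=
      ⟨fun p => by have := p.1.add_natAbs_add_lt_deg; have := p.2; omega⟩
    infer_instance
  | succ n => exact Finite.of_injective _ (toTriple_bijective n).1

theorem summable_pow_natAbs {r : ℝ} (h0 : 0 ≤ r) (h1 : r < 1) :
    Summable fun s : ℤ => r ^ s.natAbs := by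
  have h := summable_geometric_of_lt_one h0 h1
  exact Summable.of_nat_of_neg (by simpa using h) (by simpa using h)

theorem summable_pow_deg {r : ℝ} (h0 : 0 ≤ r) (h1 : r < 1) :
    Summable fun p : HermiteIndex => r ^ p.deg := by
  have h := summable_geometric_of_lt_one h0 h1
  have h2 : Summable fun p : ℕ × ℤ × ℕ => r ^ p.1 * (r ^ p.2.1.natAbs * r ^ p.2.2) :=
    h.mul_of_nonneg ((summable_pow_natAbs h0 h1).mul_of_nonneg h (fun _ => by positivity)
      (fun _ => by positivity)) (fun _ => by positivity) (fun _ => by positivity)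
  refine Summable.of_nonneg_of_le (fun _ => by positivity) (fun p => ?_)
    (h2.comp_injective Subtype.val_injective)
  simp only [Function.comp_apply, ← pow_add]
  exact pow_le_pow_of_le_one h0 h1.le (by have := p.add_natAbs_add_lt_deg; omega)

theorem summable_cpow_deg {q : ℂ} (hq : ‖q‖ < 1) :
    Summable fun p : HermiteIndex => q ^ p.deg :=
  Summable.of_norm (by simpa using summable_pow_deg (norm_nonneg q) hq)

theorem hasSum_kroneckerF {q : ℂ} (hq : ‖q‖ < 1) :
    HasSum (fun n : ℕ => (kroneckerF (4 * n - 1) : ℂ) * q ^ n)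
      (∑' p : HermiteIndex, q ^ p.deg) := by
  have h := (summable_cpow_deg hq).hasSum
  rw [← (Equiv.sigmaFiberEquiv deg).hasSum_iff] at h
  refine h.sigma fun n => ?_
  have := finite_fiber n
  have := Fintype.ofFinite {p : HermiteIndex // p.deg = n}
  have h2 := hasSum_fintype fun p : {p : HermiteIndex // p.deg = n} => q ^ n
  rw [kroneckerF_eq_card_fiber]
  convert h2 using 1
  · ext p
    simp [Equiv.sigmaFiberEquiv, p.2]
  · simp

theorem genF4_eq_tsum {q : ℂ} (hq : ‖q‖ < 1) : genF4 q = ∑' p : HermiteIndex, q ^ p.deg :=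
  (hasSum_kroneckerF hq).tsum_eq

end HermiteIndex

/-! ### Gauss's theta product via a finite identity -/

/-- The partial products of `J₁² / J₂`. -/
noncomputable def gaussProd (q : ℂ) (n : ℕ) : ℂ :=
  ∏ i ∈ Finset.range n, (1 - q ^ (i + 1)) / (1 + q ^ (i + 1))

/-- `q^s (-1; q)_s / (q; q)_s`. -/
noncomputable def gaussCoeff (q : ℂ) (s : ℕ) : ℂ :=
  q ^ s * ∏ i ∈ Finset.range s, (1 + q ^ i) / (1 - q ^ (i + 1))

theorem one_add_pow_ne_zero {q : ℂ} (hq : ‖q‖ < 1) {n : ℕ} (hn : n ≠ 0) : 1 + q ^ n ≠ 0 := by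
  intro h
  have h1 : ‖q ^ n‖ < 1 := by rw [norm_pow]; exact pow_lt_one₀ (norm_nonneg q) hq hn
  rw [show q ^ n = -1 by linear_combination h] at h1
  simp at h1

theorem one_sub_pow_ne_zero {q : ℂ} (hq : ‖q‖ < 1) {n : ℕ} (hn : n ≠ 0) : 1 - q ^ n ≠ 0 := by
  intro h
  have h1 : ‖q ^ n‖ < 1 := by rw [norm_pow]; exact pow_lt_one₀ (norm_nonneg q) hq hn
  rw [show q ^ n = 1 by linear_combination -h] at h1
  simp at h1

theorem gaussCoeff_succ {q : ℂ} (hq : ‖q‖ < 1) (s : ℕ) :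
    gaussCoeff q (s + 1) * (1 - q ^ (s + 1)) = q * gaussCoeff q s * (1 + q ^ s) := by
  have := one_sub_pow_ne_zero hq (Nat.add_one_ne_zero s)
  rw [gaussCoeff, gaussCoeff, Finset.prod_range_succ, div_eq_mul_inv (1 + q ^ s)]
  linear_combination q ^ (s + 1) * (∏ i ∈ Finset.range s, (1 + q ^ i) / (1 - q ^ (i + 1))) *
    (1 + q ^ s) * inv_mul_cancel₀ this

/-- All factors 1 - q^i cancel, and the factors 1 + q^i leave only 2/(1 + q^(n+1)). -/
theorem gaussProd_mul_gaussCoeff {q : ℂ} (hq : ‖q‖ < 1) (n : ℕ) :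
    gaussProd q (n + 1) * gaussCoeff q (n + 1) * (1 + q ^ (n + 1)) = 2 * q ^ (n + 1) := by
  induction n with
  | zero =>
    have h1 := one_sub_pow_ne_zero hq one_ne_zero
    have h2 := one_add_pow_ne_zero hq one_ne_zero
    simp only [pow_one] at h1 h2
    simp [gaussProd, gaussCoeff]
    field_simp
    ring
  | succ n ih =>
    have h1 := one_sub_pow_ne_zero hq (Nat.add_one_ne_zero (n + 1))
    have h2 := one_add_pow_ne_zero hq (Nat.add_one_ne_zero (n + 1))
    have h3 := gaussCoeff_succ hq (n + 1)
    have h4 : gaussProd q (n + 1 + 1) * (1 + q ^ (n + 1 + 1)) =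
        gaussProd q (n + 1) * (1 - q ^ (n + 1 + 1)) := by
      rw [gaussProd, Finset.prod_range_succ, ← gaussProd]
      field_simp
    calc _ = gaussProd q (n + 1) * (gaussCoeff q (n + 1 + 1) * (1 - q ^ (n + 1 + 1))) := by
          linear_combination gaussCoeff q (n + 1 + 1) * h4
      _ = q * (gaussProd q (n + 1) * gaussCoeff q (n + 1) * (1 + q ^ (n + 1))) := by
          rw [h3]; ring
      _ = _ := by rw [ih]; ring

/-- The summands telescope in s; the right-hand side is the boundary term at k and vanishes at k =
0. -/
theorem gauss_sum_step {q : ℂ} (hq : ‖q‖ < 1) (n k : ℕ) :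
    (1 + q ^ (n + 1)) * ∑ s ∈ Finset.range k, (-1) ^ s * gaussCoeff q s *
        (gaussProd q (n + 1) * q ^ ((n + 1) * s) - gaussProd q n * q ^ (n * s)) =
      (-1) ^ k * gaussProd q n * q ^ (n * k) * gaussCoeff q k * (1 - q ^ k) := by
  have h2 := one_add_pow_ne_zero hq (Nat.add_one_ne_zero n)
  have h4 : gaussProd q (n + 1) * (1 + q ^ (n + 1)) =
      gaussProd q n * (1 - q ^ (n + 1)) := by
    rw [gaussProd, Finset.prod_range_succ, ← gaussProd]
    field_simp
  induction k with
  | zero => simp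
  | succ k ih =>
    have h3 := gaussCoeff_succ hq k
    rw [Finset.sum_range_succ, mul_add, ih]
    have e1 : q ^ ((n + 1) * k) = q ^ (n * k) * q ^ k := by ring
    have e2 : q ^ (n * (k + 1)) = q ^ (n * k) * q ^ n := by ring
    have e3 : q ^ (n + 1) = q ^ n * q := by ring
    rw [e1, e2]
    rw [e3] at h4 ⊢
    linear_combination (-1) ^ k * gaussCoeff q k * q ^ (n * k) * q ^ k * h4
      + (-1) ^ k * gaussProd q n * q ^ (n * k) * q ^ n * h3

/-- From n to n+1 the left side gains the boundary term of `gauss_sum_step` and the new summand s =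
n+1. By `gaussProd_mul_gaussCoeff` together they equal 2(-1)^(n+1) q^((n+1)²). -/
theorem gauss_finite_identity {q : ℂ} (hq : ‖q‖ < 1) (n : ℕ) :
    ∑ s ∈ Finset.range (n + 1), (-1) ^ s * gaussCoeff q s * (gaussProd q n * q ^ (n * s)) =
      1 + 2 * ∑ i ∈ Finset.range n, (-1) ^ (i + 1) * q ^ ((i + 1) ^ 2) := by
  induction n with
  | zero => simp [gaussCoeff, gaussProd]
  | succ n ih =>
    have h2 := one_add_pow_ne_zero hq (Nat.add_one_ne_zero n)
    have h := gauss_sum_step hq n (n + 1)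
    have h5 := gaussProd_mul_gaussCoeff hq n
    have h4 : gaussProd q (n + 1) * (1 + q ^ (n + 1)) =
        gaussProd q n * (1 - q ^ (n + 1)) := by
      rw [gaussProd, Finset.prod_range_succ, ← gaussProd]
      field_simp
    rw [Finset.sum_range_succ, Finset.sum_range_succ (fun i => (-1 : ℂ) ^ (i + 1) * _), mul_add (2 : ℂ),
      ← add_assoc, ← ih]
    simp only [mul_sub, Finset.sum_sub_distrib] at h
    refine mul_left_cancel₀ h2 ?_
    have e1 : q ^ ((n + 1) * (n + 1)) = q ^ (n * (n + 1)) * q ^ (n + 1) := by ring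
    have e2 : q ^ ((n + 1) ^ 2) = q ^ (n * (n + 1)) * q ^ (n + 1) := by ring
    rw [e1, e2]
    linear_combination h - (-1) ^ (n + 1) * q ^ (n * (n + 1)) * gaussCoeff q (n + 1) * h4
      + (-1) ^ (n + 1) * q ^ (n * (n + 1)) * (1 + q ^ (n + 1)) * h5

theorem summable_norm_pow_mul {q : ℂ} (hq : ‖q‖ < 1) {k : ℕ} (hk : k ≠ 0) :
    Summable fun n : ℕ => ‖-(q ^ k * (q ^ k) ^ n)‖ := by
  simp only [norm_neg, norm_mul, norm_pow]
  exact (summable_geometric_of_lt_one (by positivity)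
    (pow_lt_one₀ (norm_nonneg q) hq hk)).mul_left _

theorem multipliable_bigJ {q : ℂ} (hq : ‖q‖ < 1) {k : ℕ} (hk : k ≠ 0) :
    Multipliable fun n : ℕ => 1 - q ^ k * (q ^ k) ^ n := by
  simpa [sub_eq_add_neg] using multipliable_one_add_of_summable (summable_norm_pow_mul hq hk)

theorem bigJ_ne_zero {q : ℂ} (hq : ‖q‖ < 1) {k : ℕ} (hk : k ≠ 0) : bigJ k q ≠ 0 := by
  have h := tprod_one_add_ne_zero_of_summable (f := fun n : ℕ => -(q ^ k * (q ^ k) ^ n))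
    (fun n => by
      rw [← sub_eq_add_neg, ← pow_mul, ← pow_add]
      exact one_sub_pow_ne_zero hq (by omega)) (summable_norm_pow_mul hq hk)
  simpa [bigJ, qPochInf, sub_eq_add_neg] using h

theorem tendsto_prod_bigJ {q : ℂ} (hq : ‖q‖ < 1) {k : ℕ} (hk : k ≠ 0) :
    Tendsto (fun n => ∏ i ∈ Finset.range n, (1 - (q ^ (i + 1)) ^ k)) atTop (𝓝 (bigJ k q)) := by
  convert (multipliable_bigJ hq hk).tendsto_prod_tprod_nat using 4 with n i
  · ring
  · rfl

theorem tendsto_gaussProd {q : ℂ} (hq : ‖q‖ < 1) :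
    Tendsto (gaussProd q) atTop (𝓝 (bigJ 1 q ^ 2 / bigJ 2 q)) := by
  refine (((tendsto_prod_bigJ hq one_ne_zero).pow 2).div (tendsto_prod_bigJ hq two_ne_zero)
    (bigJ_ne_zero hq two_ne_zero)).congr fun n => ?_
  rw [gaussProd, Pi.div_apply, ← Finset.prod_pow, ← Finset.prod_div_distrib]
  refine Finset.prod_congr rfl fun i _ => ?_
  rw [pow_one]
  have h1 := one_sub_pow_ne_zero hq (Nat.add_one_ne_zero i)
  have h2 := one_add_pow_ne_zero hq (Nat.add_one_ne_zero i)
  generalize q ^ (i + 1) = x at *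
  rw [show 1 - x ^ 2 = (1 - x) * (1 + x) by ring]
  field_simp

/-- The product part converges, hence is bounded, and q^s supplies geometric decay. -/
theorem summable_norm_gaussCoeff {q : ℂ} (hq : ‖q‖ < 1) :
    Summable fun s => ‖gaussCoeff q s‖ := by
  have h1 : Multipliable fun n : ℕ => 1 + q ^ n :=
    multipliable_one_add_of_summable
      (by simpa using summable_geometric_of_lt_one (norm_nonneg q) hq)
  have h2 := (h1.tendsto_prod_tprod_nat.div (tendsto_prod_bigJ hq one_ne_zero)
    (bigJ_ne_zero hq one_ne_zero)).norm
  obtain ⟨B, hB⟩ := h2.bddAbove_range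
  refine Summable.of_nonneg_of_le (fun _ => norm_nonneg _) (fun s => ?_)
    ((summable_geometric_of_lt_one (norm_nonneg q) hq).mul_right B)
  rw [gaussCoeff, norm_mul, norm_pow]
  refine mul_le_mul_of_nonneg_left ?_ (by positivity)
  have := hB (Set.mem_range_self s)
  simpa [Finset.prod_div_distrib] using this

theorem summable_pow_sq {r : ℝ} (h0 : 0 ≤ r) (h1 : r < 1) :
    Summable fun t : ℤ => r ^ (t.natAbs ^ 2) := by
  have h : Summable fun n : ℕ => r ^ (n ^ 2) :=
    Summable.of_nonneg_of_le (fun _ => by positivity)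
      (fun n => pow_le_pow_of_le_one h0 h1.le (Nat.le_self_pow two_ne_zero n))
      (summable_geometric_of_lt_one h0 h1)
  exact Summable.of_nat_of_neg (by simpa using h) (by simpa using h)

theorem summable_gauss_theta {q : ℂ} (hq : ‖q‖ < 1) :
    Summable fun t : ℤ => (-1 : ℂ) ^ t.natAbs * q ^ (t.natAbs ^ 2) :=
  Summable.of_norm (by simpa using summable_pow_sq (norm_nonneg q) hq)

/-- Gauss's product formula for `∑ (-1)^t q^(t²)`. -/
theorem gauss_theta_product {q : ℂ} (hq : ‖q‖ < 1) :
    bigJ 1 q ^ 2 / bigJ 2 q = ∑' t : ℤ, (-1 : ℂ) ^ t.natAbs * q ^ (t.natAbs ^ 2) := by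
  have hS := summable_gauss_theta hq
  have hS1 : Summable fun n : ℕ => (-1 : ℂ) ^ (n + 1) * q ^ ((n + 1) ^ 2) := by
    have := hS.comp_injective (i := fun n : ℕ => ((n + 1 : ℕ) : ℤ))
      (fun a b h => by simpa using h)
    refine this.congr fun n => ?_
    simp only [Function.comp_apply, Int.natAbs_natCast]
  have hsum : ∑' t : ℤ, (-1 : ℂ) ^ t.natAbs * q ^ (t.natAbs ^ 2) =
      1 + 2 * ∑' n : ℕ, (-1 : ℂ) ^ (n + 1) * q ^ ((n + 1) ^ 2) := by
    have e1 : ∀ n : ℕ, ((n : ℤ) + 1).natAbs = n + 1 := fun n => by omega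
    have e2 : ∀ n : ℕ, (-((n : ℤ) + 1)).natAbs = n + 1 := fun n => by omega
    rw [tsum_of_add_one_of_neg_add_one (by simpa only [e1] using hS1)
      (by simpa only [e2] using hS1)]
    simp only [e1, e2]
    simp
    ring
  obtain ⟨B, hB⟩ := (tendsto_gaussProd hq).norm.bddAbove_range
  have hB' : ∀ n, ‖gaussProd q n‖ ≤ B := fun n => hB (Set.mem_range_self n)
  let f : ℕ → ℕ → ℂ := fun n s =>
    if s < n + 1 then (-1) ^ s * gaussCoeff q s * (gaussProd q n * q ^ (n * s)) else 0
  -- As n → ∞ the factor q^(ns) kills every term of the finite identity except s = 0.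
  have hlim : Tendsto (fun n => ∑' s, f n s) atTop
      (𝓝 (∑' s, if s = 0 then bigJ 1 q ^ 2 / bigJ 2 q else 0)) := by
    refine tendsto_tsum_of_dominated_convergence
      ((summable_norm_gaussCoeff hq).mul_right B) (fun s => ?_)
      (Eventually.of_forall fun n s => ?_)
    · have hev : (fun n => (-1) ^ s * gaussCoeff q s * (gaussProd q n * (q ^ s) ^ n))
          =ᶠ[atTop] fun n => f n s := by
        filter_upwards [eventually_ge_atTop s] with n hn
        simp only [f]
        rw [if_pos (by omega), ← pow_mul, mul_comm s n]
      refine Tendsto.congr' hev ?_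
      rcases Nat.eq_zero_or_pos s with rfl | hs
      · simpa [gaussCoeff] using tendsto_gaussProd hq
      · have hqs : ‖q ^ s‖ < 1 := by
          rw [norm_pow]; exact pow_lt_one₀ (norm_nonneg q) hq hs.ne'
        have := (((tendsto_gaussProd hq).mul
          (tendsto_pow_atTop_nhds_zero_of_norm_lt_one hqs)).const_mul
            ((-1) ^ s * gaussCoeff q s))
        simpa [hs.ne'] using this
    · have hB0 : 0 ≤ B := (norm_nonneg _).trans (hB' 0)
      simp only [f]
      split_ifs
      · rw [norm_mul, norm_mul, norm_mul, norm_pow, norm_pow, norm_neg, norm_one, one_pow, one_mul]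
        refine mul_le_mul_of_nonneg_left ?_ (norm_nonneg _)
        calc _ ≤ B * 1 := mul_le_mul (hB' n) (pow_le_one₀ (norm_nonneg q) hq.le)
              (by positivity) hB0
          _ = B := mul_one B
      · simp only [norm_zero]
        positivity
  have hfin : ∀ n, ∑' s, f n s =
      1 + 2 * ∑ i ∈ Finset.range n, (-1) ^ (i + 1) * q ^ ((i + 1) ^ 2) := fun n => by
    rw [← gauss_finite_identity hq n, tsum_eq_sum (s := Finset.range (n + 1))]
    · refine Finset.sum_congr rfl fun s hs => ?_
      simp only [f]
      rw [if_pos (Finset.mem_range.1 hs)]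
    · intro s hs
      simp only [f]
      rw [if_neg (fun h => hs (Finset.mem_range.2 h))]
  simp only [hfin, tsum_ite_eq] at hlim
  rw [hsum]
  exact tendsto_nhds_unique hlim ((hS1.hasSum.tendsto_sum_nat.const_mul 2).const_add 1)

/-! ### Telescoping sums of q^(2j)/(1 + q^(2j)) -/

/-- One bound serves both signs of p: for p ≥ 0 the left factor |q|^p is at most 1, and for p < 0
the norm is of order |q|^(2p) ≥ |q|^p. In `summable_doubleTerm` this |q|^p produces the decay in m.
-/
theorem one_sub_norm_mul_zpow_le_norm_one_add {q : ℂ} (h0 : q ≠ 0) (hq : ‖q‖ < 1) (p : ℤ) :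
    (1 - ‖q‖) * ‖q‖ ^ p ≤ ‖1 + q ^ (2 * p)‖ := by
  have hr : 0 < ‖q‖ := norm_pos_iff.2 h0
  have key : ∀ n : ℕ, ‖q‖ ^ n ≤ 1 := fun n => pow_le_one₀ hr.le hq.le
  rcases eq_or_ne p 0 with rfl | hp
  · norm_num
    linarith
  rcases lt_or_ge p 0 with hneg | hpos
  · obtain ⟨n, rfl⟩ : ∃ n : ℕ, p = -((n + 1 : ℕ) : ℤ) := ⟨(-p - 1).toNat, by omega⟩
    have e1 : 1 + q ^ (2 * -((n + 1 : ℕ) : ℤ)) =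
        q ^ (2 * -((n + 1 : ℕ) : ℤ)) * (1 + q ^ (2 * (n + 1))) := by
      rw [mul_add, mul_one, ← zpow_natCast q (2 * (n + 1)), ← zpow_add₀ h0]
      push_cast
      rw [show 2 * -((n : ℤ) + 1) + 2 * (n + 1) = 0 by ring, zpow_zero, add_comm]
    have e2 : ‖q‖ ^ (2 * -((n + 1 : ℕ) : ℤ)) =
        ‖q‖ ^ (-((n + 1 : ℕ) : ℤ)) * ‖q‖ ^ (-((n + 1 : ℕ) : ℤ)) := by
      rw [← zpow_add₀ hr.ne']
      congr 1
      ring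
    have h1 : 1 - ‖q‖ ≤ ‖1 + q ^ (2 * (n + 1))‖ := by
      have := norm_sub_le_norm_add (1 : ℂ) (q ^ (2 * (n + 1)))
      rw [norm_one, norm_pow] at this
      have h2 : ‖q‖ ^ (2 * (n + 1)) ≤ ‖q‖ := pow_le_of_le_one hr.le hq.le (by omega)
      linarith
    have h3 : 1 ≤ ‖q‖ ^ (-((n + 1 : ℕ) : ℤ)) := by
      rw [zpow_neg, zpow_natCast]
      exact (one_le_inv₀ (by positivity)).2 (key _)
    rw [e1, norm_mul, norm_zpow, e2]
    have h4 : 0 ≤ 1 - ‖q‖ := by linarith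
    calc (1 - ‖q‖) * ‖q‖ ^ (-((n + 1 : ℕ) : ℤ))
        ≤ (1 - ‖q‖) * (‖q‖ ^ (-((n + 1 : ℕ) : ℤ)) * ‖q‖ ^ (-((n + 1 : ℕ) : ℤ))) := by
          refine mul_le_mul_of_nonneg_left ?_ h4
          nlinarith
      _ ≤ _ := by
          rw [mul_comm]
          exact mul_le_mul_of_nonneg_left h1 (by positivity)
  · obtain ⟨n, rfl⟩ : ∃ n : ℕ, p = ((n + 1 : ℕ) : ℤ) := ⟨(p - 1).toNat, by omega⟩
    have h1 : 1 - ‖q‖ ≤ ‖1 + q ^ (2 * (n + 1))‖ := by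
      have := norm_sub_le_norm_add (1 : ℂ) (q ^ (2 * (n + 1)))
      rw [norm_one, norm_pow] at this
      have h2 : ‖q‖ ^ (2 * (n + 1)) ≤ ‖q‖ := pow_le_of_le_one hr.le hq.le (by omega)
      linarith
    have e1 : q ^ (2 * ((n + 1 : ℕ) : ℤ)) = q ^ (2 * (n + 1)) := by
      rw [← zpow_natCast q (2 * (n + 1))]
      push_cast
      rfl
    rw [e1, zpow_natCast]
    have := key (n + 1)
    nlinarith

theorem one_add_zpow_ne_zero {q : ℂ} (h0 : q ≠ 0) (hq : ‖q‖ < 1) (p : ℤ) : 1 + q ^ p ≠ 0 := by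
  rcases Int.eq_nat_or_neg p with ⟨n, rfl | rfl⟩
  · rcases eq_or_ne n 0 with rfl | hn
    · norm_num
    · simpa using one_add_pow_ne_zero hq hn
  · rcases eq_or_ne n 0 with rfl | hn
    · norm_num
    · intro h
      refine one_add_pow_ne_zero hq hn ?_
      rw [zpow_neg, zpow_natCast] at h
      have := pow_ne_zero n h0
      field_simp at h
      linear_combination h

theorem sum_Icc_zpow_mul {x : ℂ} (hx : x ≠ 0) (m : ℕ) :
    (∑ s ∈ Finset.Icc (-(m : ℤ)) m, x ^ s) * (x - 1) = x ^ ((m : ℤ) + 1) - x ^ (-(m : ℤ)) := by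
  induction m with
  | zero => simp
  | succ m ih =>
    push_cast
    rw [Finset.Icc_succ_succ, Finset.sum_union (by
      rw [Finset.disjoint_left]; intro a; simp only [Finset.mem_Icc, Finset.mem_insert,
        Finset.mem_singleton]; omega), Finset.sum_pair (by omega), add_mul, ih]
    have e1 : x ^ (-(m : ℤ)) = x ^ (-((m : ℤ) + 1)) * x := by
      rw [← zpow_add_one₀ hx]; congr 1; ring
    have e2 : x ^ ((m : ℤ) + 1 + 1) = x ^ ((m : ℤ) + 1) * x := zpow_add_one₀ hx _
    rw [e1, e2]
    ring

/-- `q^(2j) / (1 + q^(2j))`. -/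
noncomputable def fermiTerm (q : ℂ) (j : ℤ) : ℂ := q ^ (2 * j) / (1 + q ^ (2 * j))

theorem fermiTerm_neg {q : ℂ} (h0 : q ≠ 0) (hq : ‖q‖ < 1) (j : ℤ) :
    fermiTerm q (-j) = 1 - fermiTerm q j := by
  have h1 := one_add_zpow_ne_zero h0 hq (2 * j)
  have h2 := one_add_zpow_ne_zero h0 hq (-(2 * j))
  have h3 := zpow_ne_zero (2 * j) h0
  rw [fermiTerm, fermiTerm, mul_neg]
  rw [zpow_neg] at h2 ⊢
  generalize q ^ (2 * j) = x at *
  have h4 : x + 1 ≠ 0 := by rwa [add_comm]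
  rw [show 1 + x⁻¹ = (x + 1) / x by field_simp, add_comm 1 x]
  field_simp
  ring

theorem norm_fermiTerm_le {q : ℂ} (h0 : q ≠ 0) (hq : ‖q‖ < 1) (j : ℤ) :
    ‖fermiTerm q j‖ ≤ ‖q‖ ^ j / (1 - ‖q‖) := by
  have hr : 0 < ‖q‖ := norm_pos_iff.2 h0
  have h1 := one_sub_norm_mul_zpow_le_norm_one_add h0 hq j
  have h2 : 0 < 1 - ‖q‖ := by linarith
  have h3 : 0 < ‖q‖ ^ j := zpow_pos hr j
  have h4 : ‖q‖ ^ (2 * j) = ‖q‖ ^ j * ‖q‖ ^ j := by rw [← zpow_add₀ hr.ne']; congr 1; ring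
  rw [fermiTerm, norm_div, norm_zpow, h4, div_le_div_iff₀ (lt_of_lt_of_le (by positivity) h1) h2]
  calc _ = ‖q‖ ^ j * ((1 - ‖q‖) * ‖q‖ ^ j) := by ring
    _ ≤ _ := mul_le_mul_of_nonneg_left h1 h3.le

theorem summable_fermiTerm {q : ℂ} (h0 : q ≠ 0) (hq : ‖q‖ < 1) (k : ℤ) :
    Summable fun i : ℕ => fermiTerm q (i - k) := by
  have hr : 0 < ‖q‖ := norm_pos_iff.2 h0
  refine Summable.of_norm_bounded
    (((summable_geometric_of_lt_one hr.le hq).mul_right (‖q‖ ^ (-k))).div_const (1 - ‖q‖))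
    fun i => (norm_fermiTerm_le h0 hq _).trans_eq ?_
  rw [sub_eq_add_neg, zpow_add₀ hr.ne', zpow_natCast]

/-- Reflection j ↦ -j on the window -k, …, k turns the sum S into 2k+1 - S. -/
theorem sum_range_fermiTerm {q : ℂ} (h0 : q ≠ 0) (hq : ‖q‖ < 1) (k : ℕ) :
    2 * ∑ i ∈ Finset.range (2 * k + 1), fermiTerm q (i - k) = 2 * k + 1 := by
  have h : ∑ i ∈ Finset.range (2 * k + 1), fermiTerm q (i - k) =
      ∑ i ∈ Finset.range (2 * k + 1), (1 - fermiTerm q (i - k)) := by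
    rw [← Finset.sum_range_reflect]
    refine Finset.sum_congr rfl fun i hi => ?_
    rw [← fermiTerm_neg h0 hq]
    congr 1
    have := Finset.mem_range.1 hi
    omega
  rw [Finset.sum_sub_distrib] at h
  simp only [Finset.sum_const, Finset.card_range, nsmul_eq_mul, mul_one] at h
  push_cast at h
  linear_combination h

/-- The second sequence is the first shifted by 2k+1 places, so only the first 2k+1 terms survive.
-/
theorem hasSum_fermiTerm_sub {q : ℂ} (h0 : q ≠ 0) (hq : ‖q‖ < 1) (k : ℕ) :
    HasSum (fun m : ℕ => fermiTerm q (m - k) - fermiTerm q (m + k + 1)) ((2 * k + 1) / 2) := by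
  have hs := summable_fermiTerm h0 hq k
  have h1 := hs.sum_add_tsum_nat_add (2 * k + 1)
  have h2 := ((summable_nat_add_iff (2 * k + 1)).2 hs).hasSum
  have h3 := hs.hasSum.sub h2
  have h4 := sum_range_fermiTerm h0 hq k
  have h5 : ((2 * k + 1) / 2 : ℂ) = ∑' i : ℕ, fermiTerm q (i - k) -
      ∑' i : ℕ, fermiTerm q ((i + (2 * k + 1) : ℕ) - k) := by
    rw [← h1, add_sub_cancel_right]
    linear_combination -h4 / 2
  rw [h5]
  refine Eq.subst (motive := fun f => HasSum f _) (funext fun m => ?_) h3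
  congr 2
  push_cast
  ring

/-! ### The double series and its summation over m -/

/-- The summand of the double series over `ℤ × ℕ`. -/
noncomputable def doubleTerm (q : ℂ) (n : ℤ) (m : ℕ) : ℂ :=
  (-1) ^ (n - 1) * q ^ (n ^ 2) /
    ((1 - q ^ (2 * m + 1)) * (1 + q ^ (2 * (n - m - 1))))

theorem summable_zpow_sq_sub {r : ℝ} (h0 : 0 < r) (h1 : r < 1) :
    Summable fun n : ℤ => r ^ (n ^ 2 - n) := by
  refine Summable.of_nonneg_of_le (fun _ => by positivity) (fun n => ?_)
    ((HermiteIndex.summable_pow_natAbs h0.le h1).mul_left r⁻¹)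
  rw [← zpow_natCast, Int.natCast_natAbs, ← zpow_neg_one, ← zpow_add₀ h0.ne']
  refine zpow_le_zpow_right_of_le_one₀ h0 h1.le ?_
  have h2 := le_abs_self n
  nlinarith [sq_nonneg (|n| - 1), sq_abs n]

theorem summable_doubleTerm {q : ℂ} (h0 : q ≠ 0) (hq : ‖q‖ < 1) :
    Summable fun x : ℤ × ℕ => doubleTerm q x.1 x.2 := by
  have hr : 0 < ‖q‖ := norm_pos_iff.2 h0
  have h2 : 0 < 1 - ‖q‖ := by linarith
  have hs := ((summable_zpow_sq_sub hr hq).mul_of_nonneg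
    (summable_geometric_of_lt_one hr.le hq) (fun _ => by positivity)
    (fun _ => by positivity)).mul_left (‖q‖ / (1 - ‖q‖) ^ 2)
  refine Summable.of_norm_bounded hs fun ⟨n, m⟩ => ?_
  simp only [doubleTerm]
  have h1 := one_sub_norm_mul_zpow_le_norm_one_add h0 hq (n - m - 1)
  have h3 : 1 - ‖q‖ ≤ ‖1 - q ^ (2 * m + 1)‖ := by
    have := norm_sub_norm_le (1 : ℂ) (q ^ (2 * m + 1))
    rw [norm_one, norm_pow] at this
    have h2 : ‖q‖ ^ (2 * m + 1) ≤ ‖q‖ := pow_le_of_le_one hr.le hq.le (by omega)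
    linarith
  have h4 : (1 - ‖q‖) * ((1 - ‖q‖) * ‖q‖ ^ (n - m - 1)) ≤
      ‖(1 - q ^ (2 * m + 1)) * (1 + q ^ (2 * (n - m - 1)))‖ := by
    rw [norm_mul]
    exact mul_le_mul h3 h1 (by positivity) (norm_nonneg _)
  have h5 : 0 < (1 - ‖q‖) * ((1 - ‖q‖) * ‖q‖ ^ (n - m - 1)) := by positivity
  rw [norm_div, norm_mul, norm_zpow, norm_neg, norm_one, one_zpow, one_mul, norm_zpow]
  refine (div_le_div_of_nonneg_left (by positivity) h5 h4).trans_eq ?_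
  have e1 : ‖q‖ ^ (n ^ 2) = ‖q‖ ^ (n ^ 2 - n) * ‖q‖ ^ m * ‖q‖ * ‖q‖ ^ (n - m - 1) := by
    rw [← zpow_natCast, ← zpow_add₀ hr.ne', ← zpow_add_one₀ hr.ne', ← zpow_add₀ hr.ne']
    congr 1
    ring
  rw [e1]
  have := (zpow_pos hr (n - m - 1)).ne'
  field_simp

/-- Combining the two terms produces the numerator factor (1 - q^(2k+1))(1 - q^(2m+1)), which
cancels the denominator 1 - q^(2m+1). -/
theorem doubleTerm_add_doubleTerm {q : ℂ} (h0 : q ≠ 0) (hq : ‖q‖ < 1) (k m : ℕ) :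
    doubleTerm q (k + 1) m + doubleTerm q (-k) m =
      (-1) ^ k * q ^ ((k + 1) ^ 2) / (1 + q ^ (2 * k + 1)) *
        (fermiTerm q (m - k) - fermiTerm q (m + k + 1)) := by
  have hA := one_sub_pow_ne_zero hq (show 2 * m + 1 ≠ 0 by omega)
  have hC := one_add_pow_ne_zero hq (show 2 * k + 1 ≠ 0 by omega)
  have hX := one_add_zpow_ne_zero h0 hq (2 * (m - k))
  have hY := one_add_zpow_ne_zero h0 hq (2 * (m + k + 1))
  have qk := pow_ne_zero k h0
  have qm := pow_ne_zero m h0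
  have e1 : q ^ (2 * ((k + 1 : ℤ) - m - 1)) = (q ^ k) ^ 2 / (q ^ m) ^ 2 := by
    rw [show (2 * ((k + 1 : ℤ) - m - 1)) = ((k * 2 : ℕ) : ℤ) - ((m * 2 : ℕ) : ℤ) by
      push_cast; ring, zpow_sub₀ h0, zpow_natCast, zpow_natCast, pow_mul, pow_mul]
  have e2 : q ^ (2 * (-(k : ℤ) - m - 1)) = 1 / ((q ^ k) ^ 2 * (q ^ m) ^ 2 * q ^ 2) := by
    rw [show 2 * (-(k : ℤ) - m - 1) = -((k * 2 + m * 2 + 2 : ℕ) : ℤ) by push_cast; ring,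
      zpow_neg, zpow_natCast, pow_add, pow_add, pow_mul, pow_mul, one_div]
  have e3 : q ^ (2 * ((m : ℤ) - k)) = (q ^ m) ^ 2 / (q ^ k) ^ 2 := by
    rw [show (2 * ((m : ℤ) - k)) = ((m * 2 : ℕ) : ℤ) - ((k * 2 : ℕ) : ℤ) by
      push_cast; ring, zpow_sub₀ h0, zpow_natCast, zpow_natCast, pow_mul, pow_mul]
  have e4 : q ^ (2 * ((m : ℤ) + k + 1)) = (q ^ k) ^ 2 * (q ^ m) ^ 2 * q ^ 2 := by
    rw [show 2 * ((m : ℤ) + k + 1) = ((k * 2 + m * 2 + 2 : ℕ) : ℤ) by push_cast; ring,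
      zpow_natCast, pow_add, pow_add, pow_mul, pow_mul]
  have e5 : q ^ (((k : ℤ) + 1) ^ 2) = q ^ (k ^ 2) * (q ^ k) ^ 2 * q := by
    rw [show ((k : ℤ) + 1) ^ 2 = ((k ^ 2 + k * 2 + 1 : ℕ) : ℤ) by push_cast; ring,
      zpow_natCast, pow_succ, pow_add, pow_mul]
  have e6 : q ^ ((-(k : ℤ)) ^ 2) = q ^ (k ^ 2) := by
    rw [show (-(k : ℤ)) ^ 2 = ((k ^ 2 : ℕ) : ℤ) by push_cast; ring, zpow_natCast]
  have e7 : q ^ ((k + 1) ^ 2) = q ^ (k ^ 2) * (q ^ k) ^ 2 * q := by ring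
  have e8 : (-1 : ℂ) ^ ((k : ℤ) + 1 - 1) = (-1) ^ k := by
    rw [add_sub_cancel_right, zpow_natCast]
  have e9 : (-1 : ℂ) ^ (-(k : ℤ) - 1) = -(-1) ^ k := by
    rw [zpow_sub_one₀ (by norm_num), zpow_neg, zpow_natCast, ← inv_pow]
    norm_num
  have f1 : q ^ (2 * m + 1) = (q ^ m) ^ 2 * q := by ring
  have f2 : q ^ (2 * k + 1) = (q ^ k) ^ 2 * q := by ring
  rw [doubleTerm, doubleTerm, fermiTerm, fermiTerm, e8, e9, e5, e6, e7, e1, e2, e3, e4, f1, f2]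
  rw [e3] at hX
  rw [e4] at hY
  rw [f1] at hA
  rw [f2] at hC
  generalize q ^ (k ^ 2) = z at *
  generalize (-1 : ℂ) ^ k = ε at *
  generalize q ^ k = x at *
  generalize q ^ m = y at *
  -- With the denominators as atoms A, C, D, E, the cancellation is E - qD = (1 - qx²)(1 - qy²).
  obtain ⟨A, hA'⟩ : ∃ A, A = 1 - y ^ 2 * q := ⟨_, rfl⟩
  obtain ⟨C, hC'⟩ : ∃ C, C = 1 + x ^ 2 * q := ⟨_, rfl⟩
  obtain ⟨D, hD'⟩ : ∃ D, D = x ^ 2 + y ^ 2 := ⟨_, rfl⟩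
  obtain ⟨E, hE'⟩ : ∃ E, E = 1 + x ^ 2 * y ^ 2 * q ^ 2 := ⟨_, rfl⟩
  have g1 : 1 + x ^ 2 / y ^ 2 = D / y ^ 2 := by rw [hD']; field_simp; ring
  have g2 : 1 + y ^ 2 / x ^ 2 = D / x ^ 2 := by rw [hD']; field_simp
  have g3 : 1 + 1 / (x ^ 2 * y ^ 2 * q ^ 2) = E / (x ^ 2 * y ^ 2 * q ^ 2) := by
    rw [hE']; field_simp; ring
  have hD : D ≠ 0 := fun h => hX (by rw [g2, h, zero_div])
  rw [g1, g2, g3, ← hA', ← hC', ← hE']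
  rw [← hA'] at hA
  rw [← hC'] at hC
  rw [← hE'] at hY
  field_simp
  rw [hA', hC', hD', hE']
  ring

theorem hasSum_two_mul_doubleTerm {q : ℂ} (h0 : q ≠ 0) (hq : ‖q‖ < 1) :
    HasSum (fun k : ℕ => (-1) ^ k * (2 * k + 1) * q ^ ((k + 1) ^ 2) / (1 + q ^ (2 * k + 1)))
      (2 * ∑' x : ℤ × ℕ, doubleTerm q x.1 x.2) := by
  have hs := summable_doubleTerm h0 hq
  have hfib : ∀ n : ℤ, Summable fun m => doubleTerm q n m := fun n => hs.prod_factor n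
  have h1 : HasSum (fun n : ℤ => ∑' m, doubleTerm q n m) (∑' x : ℤ × ℕ, doubleTerm q x.1 x.2) :=
    hs.hasSum.prod_fiberwise fun n => (hfib n).hasSum
  -- After negation, the pairing of k with -(k+1) becomes the pairing of n = -k with n = k+1.
  have h2 := (((Equiv.neg ℤ).hasSum_iff).2 h1).nat_add_neg_add_one.mul_left 2
  refine Eq.subst (motive := fun f => HasSum f _) (funext fun k => ?_) h2
  have h3 := (hfib ((k : ℤ) + 1)).hasSum.add (hfib (-(k : ℤ))).hasSum
  simp only [doubleTerm_add_doubleTerm h0 hq] at h3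
  have h4 := h3.unique ((hasSum_fermiTerm_sub h0 hq k).mul_left _)
  simp only [Function.comp_apply, Equiv.neg_apply, neg_neg]
  rw [add_comm (tsum _), h4]
  ring

/-! ### Multiplication by the theta series -/

/-- Reindexing of the pairs (square, Hermite index) by the difference `p = t - s`. -/
def thetaIndexEquiv :
    (Σ x : ℤ × ℕ, {s // s ∈ Finset.Icc (-(x.2 : ℤ)) x.2} × ℕ) ≃ ℤ × HermiteIndex where
  toFun y := (y.1.1 + y.2.1.1,
    ⟨(y.1.2, y.2.1.1, y.2.2), abs_le.2 (Finset.mem_Icc.1 y.2.1.2)⟩)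
  invFun z := ⟨(z.1 - z.2.1.2.1, z.2.1.1),
    (⟨z.2.1.2.1, Finset.mem_Icc.2 (abs_le.1 z.2.2)⟩, z.2.1.2.2)⟩
  left_inv := by
    rintro ⟨⟨p, m⟩, ⟨s, hs⟩, j⟩
    simp
  right_inv := by
    rintro ⟨t, ⟨m, s, j⟩, h⟩
    simp

theorem neg_one_zpow_eq_natAbs (t : ℤ) : (-1 : ℂ) ^ t = (-1) ^ t.natAbs := by
  rcases Int.eq_nat_or_neg t with ⟨n, rfl | rfl⟩
  · simp
  · rw [zpow_neg, zpow_natCast, ← inv_pow, Int.natAbs_neg, Int.natAbs_natCast]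
    norm_num

theorem theta_summand_eq {q : ℂ} (h0 : q ≠ 0) (x : ℤ × ℕ)
    (y : {s // s ∈ Finset.Icc (-(x.2 : ℤ)) x.2} × ℕ) :
    (-1 : ℂ) ^ (thetaIndexEquiv ⟨x, y⟩).1.natAbs *
        q ^ ((thetaIndexEquiv ⟨x, y⟩).1.natAbs ^ 2) * q ^ (thetaIndexEquiv ⟨x, y⟩).2.deg =
      ((-1) ^ x.1 * q ^ (x.1 ^ 2 + ((x.2 : ℤ) + 1) ^ 2)) *
        ((-q ^ (2 * x.1)) ^ y.1.1 * (q ^ (2 * x.2 + 1)) ^ y.2) := by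
  obtain ⟨p, m⟩ := x
  obtain ⟨⟨s, hs⟩, j⟩ := y
  have e1 : ∀ k : ℕ, q ^ k = q ^ (k : ℤ) := fun k => (zpow_natCast q k).symm
  have e2 : (-q ^ (2 * p)) ^ s = (-1) ^ s * q ^ (2 * p * s) := by
    rw [neg_eq_neg_one_mul, mul_zpow, ← zpow_mul]
  rw [← neg_one_zpow_eq_natAbs, e1 (_ ^ 2), e1 (HermiteIndex.deg _), HermiteIndex.coe_deg,
    ← pow_mul, e1 (_ * j), e2]
  push_cast
  rw [sq_abs]
  simp only [thetaIndexEquiv, Equiv.coe_fn_mk]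
  rw [zpow_add₀ (by norm_num : (-1 : ℂ) ≠ 0), mul_assoc, ← zpow_add₀ h0]
  rw [show (p + s) ^ 2 + (((m : ℤ) + 1) ^ 2 - s ^ 2 + (2 * m + 1) * j) =
    (p ^ 2 + ((m : ℤ) + 1) ^ 2) + 2 * p * s + (2 * m + 1) * j by ring, zpow_add₀ h0,
    zpow_add₀ h0]
  ring

/-- The geometric sum in s, of ratio -q^(2p), has two boundary terms. Completing squares turns the
exponents into (p+m+1)² and, after a factor q^(-2p) is absorbed from the denominator, (-p+m+1)². -/
theorem theta_fiber_sum {q : ℂ} (h0 : q ≠ 0) (hq : ‖q‖ < 1) (p : ℤ) (m : ℕ) :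
    ((-1) ^ p * q ^ (p ^ 2 + ((m : ℤ) + 1) ^ 2)) *
        ((∑ s ∈ Finset.Icc (-(m : ℤ)) m, (-q ^ (2 * p)) ^ s) * (1 - q ^ (2 * m + 1))⁻¹) =
      doubleTerm q (p + m + 1) m + doubleTerm q (-p + m + 1) m := by
  have hx := zpow_ne_zero (2 * p) h0
  have h := sum_Icc_zpow_mul (neg_ne_zero.2 hx) m
  have hp := one_add_zpow_ne_zero h0 hq (2 * p)
  have hA := one_sub_pow_ne_zero hq (show 2 * m + 1 ≠ 0 by omega)
  have hn : (-1 : ℂ) ≠ 0 := by norm_num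
  have hS : ∑ s ∈ Finset.Icc (-(m : ℤ)) m, (-q ^ (2 * p)) ^ s =
      (-1) ^ (m : ℤ) * (q ^ (2 * p * (m + 1)) + q ^ (-(2 * p * m))) / (1 + q ^ (2 * p)) := by
    rw [eq_div_iff hp]
    have e1 : (-q ^ (2 * p)) ^ ((m : ℤ) + 1) = -((-1) ^ (m : ℤ) * q ^ (2 * p * (m + 1))) := by
      rw [neg_eq_neg_one_mul, mul_zpow, ← zpow_mul, zpow_add_one₀ hn]
      ring
    have e2 : (-q ^ (2 * p)) ^ (-(m : ℤ)) = (-1) ^ (m : ℤ) * q ^ (-(2 * p * m)) := by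
      rw [neg_eq_neg_one_mul, mul_zpow, ← zpow_mul, neg_one_zpow_eq_natAbs,
        neg_one_zpow_eq_natAbs, Int.natAbs_neg, mul_neg]
    rw [e1, e2] at h
    linear_combination -h
  have s1 : (-1 : ℂ) ^ (p + m + 1 - 1) = (-1) ^ p * (-1) ^ (m : ℤ) := by
    rw [add_sub_cancel_right, zpow_add₀ hn]
  have s2 : (-1 : ℂ) ^ (-p + m + 1 - 1) = (-1) ^ p * (-1) ^ (m : ℤ) := by
    rw [add_sub_cancel_right, zpow_add₀ hn, neg_one_zpow_eq_natAbs (-p), Int.natAbs_neg,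
      ← neg_one_zpow_eq_natAbs]
  have t1 : q ^ ((p + m + 1) ^ 2) = q ^ (p ^ 2 + ((m : ℤ) + 1) ^ 2) * q ^ (2 * p * (m + 1)) := by
    rw [← zpow_add₀ h0]; congr 1; ring
  have t2 : q ^ ((-p + m + 1) ^ 2) = q ^ (p ^ 2 + ((m : ℤ) + 1) ^ 2) *
      (q ^ (-(2 * p * m)) * q ^ (-(2 * p))) := by
    rw [← zpow_add₀ h0, ← zpow_add₀ h0]; congr 1; ring
  have u1 : 2 * (p + m + 1 - m - 1) = 2 * p := by ring
  have u2 : 2 * (-p + m + 1 - m - 1) = -(2 * p) := by ring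
  have hp2 : 1 + q ^ (-(2 * p)) = (1 + q ^ (2 * p)) * q ^ (-(2 * p)) := by
    rw [zpow_neg]; field_simp; ring
  have hx2 := zpow_ne_zero (-(2 * p)) h0
  rw [doubleTerm, doubleTerm, s1, s2, t1, t2, u1, u2, hp2, hS]
  generalize 1 + q ^ (2 * p) = D at *
  generalize 1 - q ^ (2 * m + 1) = A at *
  field_simp

theorem theta_fiber_tsum {q : ℂ} (h0 : q ≠ 0) (hq : ‖q‖ < 1) (x : ℤ × ℕ) :
    ∑' y : {s // s ∈ Finset.Icc (-(x.2 : ℤ)) x.2} × ℕ,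
      (-1 : ℂ) ^ (thetaIndexEquiv ⟨x, y⟩).1.natAbs *
        q ^ ((thetaIndexEquiv ⟨x, y⟩).1.natAbs ^ 2) * q ^ (thetaIndexEquiv ⟨x, y⟩).2.deg =
      doubleTerm q (x.1 + x.2 + 1) x.2 + doubleTerm q (-x.1 + x.2 + 1) x.2 := by
  have hA : ‖q ^ (2 * x.2 + 1)‖ < 1 := by
    rw [norm_pow]; exact pow_lt_one₀ (norm_nonneg q) hq (by omega)
  have hg : Summable fun j : ℕ => ‖(q ^ (2 * x.2 + 1)) ^ j‖ :=
    summable_norm_geometric_of_norm_lt_one hA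
  simp only [theta_summand_eq h0]
  rw [tsum_mul_left, ← tsum_mul_tsum_of_summable_norm (f := fun s : {s // s ∈ Finset.Icc
    (-(x.2 : ℤ)) x.2} => (-q ^ (2 * x.1)) ^ s.1) (hasSum_fintype _).summable hg,
    tsum_geometric_of_norm_lt_one hA,
    Finset.tsum_subtype (Finset.Icc (-(x.2 : ℤ)) x.2) fun s => (-q ^ (2 * x.1)) ^ s,
    theta_fiber_sum h0 hq]

/-- The bijection `(p, m) ↦ (p + m + 1, m)`. -/
def shearEquiv : ℤ × ℕ ≃ ℤ × ℕ where
  toFun x := (x.1 + x.2 + 1, x.2)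
  invFun x := (x.1 - x.2 - 1, x.2)
  left_inv := by
    rintro ⟨p, m⟩
    simp only [Prod.mk.injEq, and_true]
    ring
  right_inv := by
    rintro ⟨n, m⟩
    simp only [Prod.mk.injEq, and_true]
    ring

/-- Both (p, m) ↦ (±p+m+1, m) are bijections of ℤ × ℕ, so each half contributes the full sum. -/
theorem tsum_shear_add_tsum_shear_neg {f : ℤ → ℕ → ℂ}
    (hf : Summable fun x : ℤ × ℕ => f x.1 x.2) :
    ∑' x : ℤ × ℕ, (f (x.1 + x.2 + 1) x.2 + f (-x.1 + x.2 + 1) x.2) =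
      2 * ∑' x : ℤ × ℕ, f x.1 x.2 := by
  have h1 : HasSum (fun x : ℤ × ℕ => f (x.1 + x.2 + 1) x.2) (∑' x : ℤ × ℕ, f x.1 x.2) :=
    shearEquiv.hasSum_iff.2 hf.hasSum
  have h2 : HasSum (fun x : ℤ × ℕ => f (-x.1 + x.2 + 1) x.2) (∑' x : ℤ × ℕ, f x.1 x.2) :=
    (((Equiv.neg ℤ).prodCongr (Equiv.refl ℕ)).trans shearEquiv).hasSum_iff.2 hf.hasSum
  rw [two_mul]
  exact (h1.add h2).tsum_eq

theorem theta_mul_tsum {q : ℂ} (h0 : q ≠ 0) (hq : ‖q‖ < 1) :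
    (∑' t : ℤ, (-1 : ℂ) ^ t.natAbs * q ^ (t.natAbs ^ 2)) * ∑' p : HermiteIndex, q ^ p.deg =
      2 * ∑' x : ℤ × ℕ, doubleTerm q x.1 x.2 := by
  have hn1 : Summable fun t : ℤ => ‖(-1 : ℂ) ^ t.natAbs * q ^ (t.natAbs ^ 2)‖ := by
    simpa using summable_pow_sq (norm_nonneg q) hq
  have hn2 : Summable fun p : HermiteIndex => ‖q ^ p.deg‖ := by
    simpa using HermiteIndex.summable_pow_deg (norm_nonneg q) hq
  have hsum := summable_mul_of_summable_norm hn1 hn2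
  have hsum' : Summable fun c => (-1 : ℂ) ^ (thetaIndexEquiv c).1.natAbs *
      q ^ ((thetaIndexEquiv c).1.natAbs ^ 2) * q ^ (thetaIndexEquiv c).2.deg :=
    (thetaIndexEquiv.summable_iff (f := fun z : ℤ × HermiteIndex =>
      (-1 : ℂ) ^ z.1.natAbs * q ^ (z.1.natAbs ^ 2) * q ^ z.2.deg)).2 hsum
  rw [tsum_mul_tsum_of_summable_norm hn1 hn2, ← thetaIndexEquiv.tsum_eq, hsum'.tsum_sigma,
    tsum_congr (theta_fiber_tsum h0 hq),
    tsum_shear_add_tsum_shear_neg (summable_doubleTerm h0 hq)]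

/-! ### The identity -/

theorem hasSum_bigJ_mul_genF4 {q : ℂ} (hq : ‖q‖ < 1) :
    HasSum (fun k : ℕ => (-1) ^ k * (2 * k + 1) * q ^ ((k + 1) ^ 2) / (1 + q ^ (2 * k + 1)))
      (bigJ 1 q ^ 2 / bigJ 2 q * genF4 q) := by
  -- Negative powers of q require q ≠ 0; at q = 0 both sides vanish because F(-1) = 0.
  rcases eq_or_ne q 0 with rfl | h0
  · have h : genF4 0 = 0 := by
      rw [genF4, tsum_eq_single 0 fun n hn => by simp [hn]]
      simp [kroneckerF]
    simp [h]
  · rw [HermiteIndex.genF4_eq_tsum hq, gauss_theta_product hq, theta_mul_tsum h0 hq]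
    exact hasSum_two_mul_doubleTerm h0 hq

theorem mainTheorem11 (q : ℂ) (hq : ‖q‖ < 1) :
    -- the two infinite products converge and the denominator does not vanish
    Multipliable (fun n : ℕ => 1 - q ^ 1 * (q ^ 1) ^ n) ∧
    Multipliable (fun n : ℕ => 1 - q ^ 2 * (q ^ 2) ^ n) ∧
    bigJ 2 q ≠ 0 ∧
    -- both series converge (absolutely), with nonzero denominators on the right
    Summable (fun n : ℕ => (kroneckerF (4 * n - 1) : ℂ) * q ^ n) ∧
    (∀ k : ℕ+, 1 + q ^ (2 * (k : ℕ) - 1) ≠ 0) ∧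
    Summable (fun k : ℕ+ => (-1 : ℂ) ^ ((k : ℕ) - 1) * (2 * (k : ℂ) - 1) * q ^ ((k : ℕ) ^ 2) /
      (1 + q ^ (2 * (k : ℕ) - 1))) ∧
    -- the identity
    bigJ 1 q ^ 2 / bigJ 2 q * genF4 q =
      ∑' k : ℕ+, (-1 : ℂ) ^ ((k : ℕ) - 1) * (2 * (k : ℂ) - 1) * q ^ ((k : ℕ) ^ 2) /
        (1 + q ^ (2 * (k : ℕ) - 1)) := by
  have h : HasSum (fun k : ℕ+ => (-1 : ℂ) ^ ((k : ℕ) - 1) * (2 * (k : ℂ) - 1) *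
      q ^ ((k : ℕ) ^ 2) / (1 + q ^ (2 * (k : ℕ) - 1))) (bigJ 1 q ^ 2 / bigJ 2 q * genF4 q) := by
    refine (hasSum_pnat_iff_hasSum_succ (f := fun k : ℕ => (-1 : ℂ) ^ (k - 1) *
      (2 * (k : ℂ) - 1) * q ^ (k ^ 2) / (1 + q ^ (2 * k - 1)))).2 ?_
    refine Eq.subst (motive := fun f => HasSum f _) (funext fun k => ?_)
      (hasSum_bigJ_mul_genF4 hq)
    rw [Nat.add_sub_cancel, show 2 * (k + 1) - 1 = 2 * k + 1 by omega]
    push_cast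
    ring
  exact ⟨multipliable_bigJ hq one_ne_zero, multipliable_bigJ hq two_ne_zero,
    bigJ_ne_zero hq two_ne_zero, (HermiteIndex.hasSum_kroneckerF hq).summable,
    fun k => one_add_pow_ne_zero hq (by have := k.pos; omega), h.summable, h.tsum_eq.symm⟩
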